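/- **Lemma (Adversarial model: Nesterov (convex)).** Let $\sigma,R>0$, $\widetilde R\ge 0$ and $C,\widetilde C$ be constants. Consider a sequence of least squares problems $$\min_{x\in\mathbb R^d} f(x)=\tfrac1{2n}\|Ax-b\|^2,\qquad b=A\widetilde x+\eta,\qquad A\in\mathbb R^{n\times d},$$ in which $d\to\infty$ and $d/n\to r=1$. The initial vector $x_0\in\mathbb R^d$, the signal $\widetilde x\in\mathbb R^d$ and the noise $\eta\in\mathbb R^n$ are random vectors such that, for each problem in the sequence: the entries of $x_0-\widetilde x$ are i.i.d. with $\mathbb E[x_0-\widetilde x]=0$, $\mathbb E\|x_0-\widetilde x\|^2=R^2$ and $\mathbb E[(x_0-\widetilde x)_i^4]\le C/d^2$; the entries of $\eta$ are i.i.d. with $\mathbb E[\eta]=0$, $\mathbb E[\eta_i^2]=\widetilde R^2$ and $\mathbb E[\eta_i^4]\le\widetilde C$; and $x_0-\widetilde x$ is independent of $\eta$. Let $\lambda^{\pm}=\sigma^2(1\pm\sqrt r)^2$ be the edges of the Marčenko–Pastur law with ratio $r=1$, so $\lambda^-=0$ and $\lambda^+=4\sigma^2$. For a deterministic matrix $A$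 put $H=\frac1nA^TA$, with largest eigenvalue $\lambda_H^+$, and let $x_k$ be the iterates of Nesterov's method for convex objectives: $y_0=x_0$ and, for $k\ge0$, $$x_{k+1}=y_k-\tfrac1{\lambda_H^+}\nabla f(y_k),\qquad y_{k+1}=x_{k+1}+\tfrac{k}{k+3}(x_{k+1}-x_k).$$ Consider the maximum of $\mathbb E\|\nabla f(x_k)\|^2$ over all (deterministic) $A\in\mathbb R^{n\times d}$ for which the convex hull of the eigenvalues of $H$ equals $[\lambda^-,\lambda^+]$. For every $k$ these expectations are finite, the maximum is attained for all sufficiently late problems in the sequence, and its limit $$L_k=\lim_{d\to\infty}\max_{H}\mathbb E\|\nabla f(x_k)\|^2$$ exists. Moreover, as $k\to\infty$: 1. if $\widetilde R=0$ (no noise), then $\displaystyle L_k\sim\frac{8e^{-1/2}}{\sqrt2\,\pi}(\lambda^+)^2R^2\,k^{-7/2}$; 2. if $\widetilde R>0$, then $\displaystyle L_k\sim4\,\|J_1^2\|_\infty\,\lambda^+\widetilde R^2\,k^{-2}$, where $J_1$ is the Bessel function of the first kind of order one and $\|J_1^2\|_\infty=\sup_{x\ge0}J_1(x)^2$. -/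

import Mathlib

open MeasureTheory ProbabilityTheory Filter Topology Asymptotics

noncomputable section

namespace AdversarialNesterov

/-- The upper edge `λ⁺ = σ² (1 + √r)²` of the Marchenko–Pastur law with variance `σ²` and
ratio `r`. -/
def mpUpperEdge (σ r : ℝ) : ℝ := σ ^ 2 * (1 + Real.sqrt r) ^ 2

/-- The lower edge `λ⁻ = σ² (1 - √r)²` of the Marchenko–Pastur law with variance `σ²` and
ratio `r`. -/
def mpLowerEdge (σ r : ℝ) : ℝ := σ ^ 2 * (1 - Real.sqrt r) ^ 2

/-- The Bessel function of the first kind of order one, by Bessel's integral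
`J₁(x) = (1/π) ∫₀^π cos (τ - x sin τ) dτ`. -/
def besselJ1 (x : ℝ) : ℝ :=
  1 / Real.pi * ∫ τ in (0 : ℝ)..Real.pi, Real.cos (τ - x * Real.sin τ)

/-- `‖J₁²‖_∞`, the supremum of `J₁(x)²` over `x ∈ [0, ∞)`. -/
def besselJ1SqSup : ℝ := sSup ((fun x => besselJ1 x ^ 2) '' Set.Ici 0)

variable {n d : ℕ}

/-- The matrix-vector product `A x` between Euclidean spaces. -/
def applyMatrix (A : Matrix (Fin n) (Fin d) ℝ) (x : EuclideanSpace ℝ (Fin d)) :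
    EuclideanSpace ℝ (Fin n) :=
  WithLp.toLp 2 (A.mulVec x.ofLp)

/-- The least squares objective `f(x) = (1/(2n)) ‖A x - b‖²`. -/
def lsObjective (A : Matrix (Fin n) (Fin d) ℝ) (b : EuclideanSpace ℝ (Fin n))
    (x : EuclideanSpace ℝ (Fin d)) : ℝ :=
  1 / (2 * (n : ℝ)) * ‖applyMatrix A x - b‖ ^ 2

/-- The matrix `H = (1/n) Aᵀ A`. -/
def hessianMatrix (A : Matrix (Fin n) (Fin d) ℝ) : Matrix (Fin d) (Fin d) ℝ :=
  (1 / (n : ℝ)) • (A.transpose * A)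

/-- The largest eigenvalue `λ_H⁺` of `H = (1/n) Aᵀ A`. -/
def topEigenvalue (A : Matrix (Fin n) (Fin d) ℝ) : ℝ :=
  sSup (spectrum ℝ (hessianMatrix A))

/-- The pair `(x_k, y_k)` of Nesterov's accelerated method (convex case) on `f`, with step size `α`:
`y₀ = x₀`, `x_{k+1} = y_k - α ∇f(y_k)`, `y_{k+1} = x_{k+1} + (k/(k+3)) (x_{k+1} - x_k)`. -/
def nesterovPair (f : EuclideanSpace ℝ (Fin d) → ℝ) (α : ℝ) (x₀ : EuclideanSpace ℝ (Fin d)) :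
    ℕ → EuclideanSpace ℝ (Fin d) × EuclideanSpace ℝ (Fin d)
  | 0 => (x₀, x₀)
  | k + 1 =>
    let x := (nesterovPair f α x₀ k).1
    let y := (nesterovPair f α x₀ k).2
    let x' := y - α • gradient f y
    (x', x' + ((k : ℝ) / ((k : ℝ) + 3)) • (x' - x))

/-- `‖∇f(x_k)‖²`, where `x_k` is the `k`-th iterate of Nesterov's method (convex case), with step
size `1/λ_H⁺` and initial vector `x₀`, on the least squares problem with data matrix `A` and
target `b = A x̃ + η`. -/
def nesterovGradSq (A : Matrix (Fin n) (Fin d) ℝ) (x₀ xs : EuclideanSpace ℝ (Fin d))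
    (η : EuclideanSpace ℝ (Fin n)) (k : ℕ) : ℝ :=
  let f := lsObjective A (applyMatrix A xs + η)
  ‖gradient f (nesterovPair f (1 / topEigenvalue A) x₀ k).1‖ ^ 2

/-- The assumption on the random initial vector `x₀`, the signal `x̃` (here `xs`) and the noise `η`:
the entries of `x₀ - x̃` are i.i.d., centred, with `E‖x₀ - x̃‖² = R²` and fourth moments at most
`C / d²`; the entries of `η` are i.i.d., centred, with variance `R̃²` (here `Rt`) and fourth moments
at most `Ct`; and `x₀ - x̃` is independent of `η`. -/
structure VectorAssumption {Ω : Type*} [MeasurableSpace Ω] (P : Measure Ω)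
    (x₀ xs : Ω → EuclideanSpace ℝ (Fin d)) (η : Ω → EuclideanSpace ℝ (Fin n))
    (R Rt C Ct : ℝ) : Prop where
  measurable_init : Measurable x₀
  measurable_signal : Measurable xs
  measurable_noise : Measurable η
  diff_iIndep : iIndepFun (fun (i : Fin d) ω => (x₀ ω - xs ω) i) P
  diff_identDistrib : ∀ i j : Fin d,
    IdentDistrib (fun ω => (x₀ ω - xs ω) i) (fun ω => (x₀ ω - xs ω) j) P P
  diff_mean : ∀ i : Fin d, ∫ ω, (x₀ ω - xs ω) i ∂P = 0
  diff_sq : ∫ ω, ‖x₀ ω - xs ω‖ ^ 2 ∂P = R ^ 2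
  diff_fourth_integrable : ∀ i : Fin d, Integrable (fun ω => (x₀ ω - xs ω) i ^ 4) P
  diff_fourth : ∀ i : Fin d, ∫ ω, (x₀ ω - xs ω) i ^ 4 ∂P ≤ C / (d : ℝ) ^ 2
  noise_iIndep : iIndepFun (fun (i : Fin n) ω => η ω i) P
  noise_identDistrib : ∀ i j : Fin n, IdentDistrib (fun ω => η ω i) (fun ω => η ω j) P P
  noise_mean : ∀ i : Fin n, ∫ ω, η ω i ∂P = 0
  noise_sq : ∀ i : Fin n, ∫ ω, η ω i ^ 2 ∂P = Rt ^ 2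
  noise_fourth_integrable : ∀ i : Fin n, Integrable (fun ω => η ω i ^ 4) P
  noise_fourth : ∀ i : Fin n, ∫ ω, η ω i ^ 4 ∂P ≤ Ct
  indep : IndepFun (fun ω => x₀ ω - xs ω) η P

/-- The data matrices available to the adversary: the convex hull of the eigenvalues of
`H = (1/n) Aᵀ A` equals `[lo, hi]`. -/
def feasibleMatrices (n d : ℕ) (lo hi : ℝ) : Set (Matrix (Fin n) (Fin d) ℝ) :=
  {A | convexHull ℝ (spectrum ℝ (hessianMatrix A)) = Set.Icc lo hi}

/-- The values `E‖∇f(x_k)‖²` which the adversary can reach. -/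
def adversarialValues {Ω : Type*} [MeasurableSpace Ω] (P : Measure Ω)
    (x₀ xs : Ω → EuclideanSpace ℝ (Fin d)) (η : Ω → EuclideanSpace ℝ (Fin n))
    (lo hi : ℝ) (k : ℕ) : Set ℝ :=
  (fun A => ∫ ω, nesterovGradSq A (x₀ ω) (xs ω) (η ω) k ∂P) '' feasibleMatrices n d lo hi

end AdversarialNesterov

end

open AdversarialNesterov

/-! The gradient of a quadratic is affine, so `∇f(x_k) = p_k(H/λ⁺) ∇f(x₀)` for a polynomial `p_k`,
with `∇f(x₀) = H(x₀ - x̃) - Aᵀη/n`. Independence and centring turn the expectation into a sum over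
eigenvalues of `φ(λ) = (R²λ²/d + R̃²λ/n) p_k(λ/λ⁺)²`. Feasibility forces one eigenvalue to be `0`
and one to be `λ⁺`; at most `n` are nonzero, and `φ(0) = 0`. The best choice therefore puts the
remaining `min(n, d-1) - 1` eigenvalues at a maximiser of `φ` (`isGreatest_adversarialValues`). As
`d → ∞` and `d/n → 1`, the single term at `λ⁺` vanishes and `L_k` is the maximum of `(R²λ² + R̃²λ)
p_k(λ/λ⁺)²` over `[0, λ⁺]`.

For large `k` the key identity is `p_{n+1}(1 - s²) = s^{n+2} G_n(s)`, where `G_n` is the Gegenbauer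
polynomial of parameter `3/2` with `G_n(1) = 1` (`residual_succ_eq`). Put `s = cos φ` and `u = sin²
φ`.

Noise: the maximum of `u p(u)²` sits at `φ ~ 1/n`, where the Mehler–Heine formula turns it into `4
J₁² / n²`; larger `φ` are negligible.

Signal: the maximum of `u² p(u)²` sits at `φ ~ n^{-1/2}`, in the oscillatory range. There `sin³φ
G_n²` oscillates below the envelope `8/(π n³)`: the Liouville normal form has two monotone energies
of Sonin type, which reduce the envelope to the values at `φ = π/2`, and Wallis' product evaluates
those. The other factor `sin φ cos^{2n+4} φ` peaks at about `e^{-1/2}/√(2n)`, and a critical point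
of the oscillation always lies close enough to that peak.

With noise, the signal part of order `k^{-7/2}` is negligible against `k^{-2}`. -/

namespace AdversarialNesterov

/-! ### Gegenbauer polynomials: structure relations and differential equation -/

/-- The Gegenbauer polynomials of parameter `3/2`, normalised to take the value `1` at `1`. -/
noncomputable def gegenbauer : ℕ → Polynomial ℝ
  | 0 => 1
  | 1 => Polynomial.X
  | n + 2 => Polynomial.C ((2 * n + 5) / (n + 4) : ℝ) * (Polynomial.X * gegenbauer (n + 1)) -
      Polynomial.C ((n + 1) / (n + 4) : ℝ) * gegenbauer n

theorem gegenbauer_recurrence (n : ℕ) (x : ℝ) :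
    (n + 4) * (gegenbauer (n + 2)).eval x =
      (2 * n + 5) * x * (gegenbauer (n + 1)).eval x - (n + 1) * (gegenbauer n).eval x := by
  have h : (n + 4 : ℝ) ≠ 0 := by positivity
  simp only [gegenbauer, Polynomial.eval_sub, Polynomial.eval_mul, Polynomial.eval_C,
    Polynomial.eval_X]
  field_simp

theorem gegenbauer_derivative_recurrence (n : ℕ) (x : ℝ) :
    (n + 4) * (gegenbauer (n + 2)).derivative.eval x =
      (2 * n + 5) * ((gegenbauer (n + 1)).eval x + x * (gegenbauer (n + 1)).derivative.eval x)
        - (n + 1) * (gegenbauer n).derivative.eval x := by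
  have h : (n + 4 : ℝ) ≠ 0 := by positivity
  simp only [gegenbauer, Polynomial.derivative_sub, Polynomial.derivative_mul,
    Polynomial.derivative_C, Polynomial.derivative_X, Polynomial.eval_sub, Polynomial.eval_mul,
    Polynomial.eval_C, Polynomial.eval_X, Polynomial.eval_add, Polynomial.eval_zero,
    Polynomial.eval_one]
  field_simp
  ring

/-- The lowering and raising relations go through only together: the next lowering relation uses
both previous ones. -/
theorem one_sub_sq_mul_derivative_gegenbauer (n : ℕ) (x : ℝ) :
    (1 - x ^ 2) * (gegenbauer (n + 1)).derivative.eval x =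
        (n + 1) * ((gegenbauer n).eval x - x * (gegenbauer (n + 1)).eval x) ∧
      (1 - x ^ 2) * (gegenbauer n).derivative.eval x =
        (n + 3) * (x * (gegenbauer n).eval x - (gegenbauer (n + 1)).eval x) := by
  induction n with
  | zero => simp [gegenbauer]; ring
  | succ n ih =>
    obtain ⟨h1, h2⟩ := ih
    have hr := gegenbauer_recurrence n x
    have hd := gegenbauer_derivative_recurrence n x
    have h : (n + 4 : ℝ) ≠ 0 := by positivity
    push_cast
    constructor
    · apply mul_left_cancel₀ h
      linear_combination (1 - x ^ 2) * hd + (2 * n + 5) * x * h1 - (n + 1) * h2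
        + (n + 2) * x * hr
    · linear_combination h1 + hr

/-- Differentiate the second structure relation and eliminate the derivative of `gegenbauer (n + 1)`
by the first. This leaves an extra factor `1 - x ^ 2`, which `hx` allows to be cancelled. -/
theorem gegenbauer_ode (n : ℕ) {x : ℝ} (hx : x ^ 2 ≠ 1) :
    (1 - x ^ 2) * (gegenbauer n).derivative.derivative.eval x
      - 4 * x * (gegenbauer n).derivative.eval x + n * (n + 3) * (gegenbauer n).eval x = 0 := by
  have hx' : 1 - x ^ 2 ≠ 0 := fun h => hx (by linarith)
  have key : (1 - Polynomial.X ^ 2) * (gegenbauer n).derivative =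
      Polynomial.C (n + 3 : ℝ) * (Polynomial.X * gegenbauer n - gegenbauer (n + 1)) :=
    Polynomial.funext fun y => by
      simpa using (one_sub_sq_mul_derivative_gegenbauer n y).2
  have hd := congrArg (fun p : Polynomial ℝ => p.derivative.eval x) key
  simp only [Polynomial.derivative_mul, Polynomial.derivative_sub, Polynomial.derivative_one,
    Polynomial.derivative_X_pow, Polynomial.derivative_C, Polynomial.derivative_X,
    Polynomial.eval_sub, Polynomial.eval_mul, Polynomial.eval_add, Polynomial.eval_pow,
    Polynomial.eval_C, Polynomial.eval_X, Polynomial.eval_one, Polynomial.eval_zero] at hd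
  obtain ⟨h1, h2⟩ := one_sub_sq_mul_derivative_gegenbauer n x
  apply mul_left_cancel₀ hx'
  push_cast at hd
  linear_combination (1 - x ^ 2) * hd - (n + 3 : ℝ) * h1 + (n + 1) * x * h2

/-! ### Laplace-type integral representation -/

/-- The weighted integral of Laplace's type representing the Gegenbauer polynomials. -/
noncomputable def laplaceIntegral (n : ℕ) (x y : ℝ) : ℂ :=
  ∫ θ in (0 : ℝ)..Real.pi, ((x : ℂ) + y * Real.cos θ * Complex.I) ^ n * (Real.sin θ : ℂ) ^ 2

theorem integral_sin_sq_complex :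
    ∫ θ in (0 : ℝ)..Real.pi, (Real.sin θ : ℂ) ^ 2 = (Real.pi : ℂ) / 2 := by
  have h := integral_sin_sq (a := 0) (b := Real.pi)
  simp only [Real.sin_zero, Real.sin_pi, zero_mul, sub_self, sub_zero, zero_add] at h
  have h2 : ∫ θ in (0 : ℝ)..Real.pi, (Real.sin θ : ℂ) ^ 2 =
      ((∫ θ in (0 : ℝ)..Real.pi, Real.sin θ ^ 2 : ℝ) : ℂ) := by
    rw [← intervalIntegral.integral_ofReal]; simp
  rw [h2, h]; simp

/-- The corresponding combination of integrands is the `θ`-derivative of `i y (x + i y cos θ)^(n+1)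
sin³ θ`, which vanishes at `0` and `π`. -/
theorem laplaceIntegral_recurrence (n : ℕ) {x y : ℝ} (hxy : x ^ 2 + y ^ 2 = 1) :
    (n + 4) * laplaceIntegral (n + 2) x y =
      (2 * n + 5) * x * laplaceIntegral (n + 1) x y - (n + 1) * laplaceIntegral n x y := by
  have hc : ∀ m : ℕ, IntervalIntegrable (fun θ : ℝ =>
      ((x : ℂ) + y * Real.cos θ * Complex.I) ^ m * (Real.sin θ : ℂ) ^ 2) volume 0 Real.pi :=
    fun m => Continuous.intervalIntegrable (by fun_prop) _ _
  have hderiv : ∀ θ : ℝ, HasDerivAt (fun θ : ℝ => y * Complex.I *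
      (((x : ℂ) + y * Real.cos θ * Complex.I) ^ (n + 1) * (Real.sin θ : ℂ) ^ 3))
      ((n + 4) * (((x : ℂ) + y * Real.cos θ * Complex.I) ^ (n + 2) * (Real.sin θ : ℂ) ^ 2)
        - (2 * n + 5) * x * (((x : ℂ) + y * Real.cos θ * Complex.I) ^ (n + 1) *
          (Real.sin θ : ℂ) ^ 2)
        + (n + 1) * (((x : ℂ) + y * Real.cos θ * Complex.I) ^ n * (Real.sin θ : ℂ) ^ 2)) θ := by
    intro θ
    have hcos := (Real.hasDerivAt_cos θ).ofReal_comp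
    have hsin := (Real.hasDerivAt_sin θ).ofReal_comp
    have hz := ((hcos.const_mul (y : ℂ)).mul_const Complex.I).const_add (x : ℂ)
    have := ((hz.pow (n + 1)).mul (hsin.pow 3)).const_mul (y * Complex.I)
    refine this.congr_deriv ?_
    have h1 : (x : ℂ) ^ 2 + y ^ 2 = 1 := by exact_mod_cast hxy
    have h2 : (Real.sin θ : ℂ) ^ 2 + (Real.cos θ : ℂ) ^ 2 = 1 := by
      exact_mod_cast Real.sin_sq_add_cos_sq θ
    simp only [Pi.pow_apply, Nat.add_sub_cancel]
    push_cast
    push_cast at h2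
    generalize Complex.sin θ = S at *
    generalize Complex.cos θ = K at *
    have hI : Complex.I ^ 2 = -1 := Complex.I_sq
    generalize Complex.I = J at *
    simp only [pow_succ _ (n + 1), pow_succ _ n]
    generalize ((x : ℂ) + y * K * J) ^ n = Z
    linear_combination ((n + 1) * S ^ 2 * Z) * h1 + ((n + 1) * Z * S ^ 2 * y ^ 2) * h2
      + (-(n + 1) * Z * y ^ 2 * S ^ 2 * (S ^ 2 + K ^ 2)) * hI
  have h := intervalIntegral.integral_eq_sub_of_hasDerivAt (a := 0) (b := Real.pi)
    (fun θ _ => hderiv θ) (Continuous.intervalIntegrable (by fun_prop) _ _)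
  rw [intervalIntegral.integral_add (((hc _).const_mul _).sub ((hc _).const_mul _))
    ((hc _).const_mul _), intervalIntegral.integral_sub ((hc _).const_mul _) ((hc _).const_mul _),
    intervalIntegral.integral_const_mul, intervalIntegral.integral_const_mul,
    intervalIntegral.integral_const_mul] at h
  simp only [Real.sin_pi, Real.sin_zero, Complex.ofReal_zero] at h
  simp only [laplaceIntegral]
  linear_combination h

theorem laplaceIntegral_eq (n : ℕ) {x y : ℝ} (hxy : x ^ 2 + y ^ 2 = 1) :
    laplaceIntegral n x y = (Real.pi / 2 : ℂ) * ((gegenbauer n).eval x : ℝ) := by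
  induction n using Nat.twoStepInduction with
  | zero => simpa [laplaceIntegral, gegenbauer] using integral_sin_sq_complex
  | one =>
    have h0 : ∫ θ in (0 : ℝ)..Real.pi, (Real.sin θ : ℂ) ^ 2 * Real.cos θ = 0 := by
      have := intervalIntegral.integral_eq_sub_of_hasDerivAt (a := 0) (b := Real.pi)
        (f := fun θ : ℝ => ((Real.sin θ : ℂ)) ^ 3 / 3)
        (f' := fun θ : ℝ => (Real.sin θ : ℂ) ^ 2 * Real.cos θ)
        (fun θ _ => by
          refine (((Real.hasDerivAt_sin θ).ofReal_comp.pow 3).div_const 3).congr_deriv ?_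
          push_cast; ring) (Continuous.intervalIntegrable (by fun_prop) _ _)
      simpa using this
    have : ∀ θ : ℝ, ((x : ℂ) + y * Real.cos θ * Complex.I) ^ 1 * (Real.sin θ : ℂ) ^ 2 =
        x * (Real.sin θ : ℂ) ^ 2 + (y * Complex.I) * ((Real.sin θ : ℂ) ^ 2 * Real.cos θ) := by
      intro θ; ring
    simp only [laplaceIntegral, this]
    rw [intervalIntegral.integral_add (Continuous.intervalIntegrable (by fun_prop) _ _)
      (Continuous.intervalIntegrable (by fun_prop) _ _), intervalIntegral.integral_const_mul,
      intervalIntegral.integral_const_mul, h0, integral_sin_sq_complex]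
    simp [gegenbauer]; ring
  | more n ih0 ih1 =>
    have h : (n + 4 : ℂ) ≠ 0 := by exact_mod_cast (by positivity : (n + 4 : ℝ) ≠ 0)
    apply mul_left_cancel₀ h
    rw [laplaceIntegral_recurrence n hxy, ih0, ih1]
    have hr : ((n + 4 : ℂ)) * ((gegenbauer (n + 2)).eval x : ℝ) =
      (2 * n + 5) * x * ((gegenbauer (n + 1)).eval x : ℝ) - (n + 1) * ((gegenbauer n).eval x : ℝ) :=
      by exact_mod_cast gegenbauer_recurrence n x
    linear_combination -(Real.pi / 2 : ℂ) * hr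

theorem gegenbauer_eq_integral (n : ℕ) {x y : ℝ} (hxy : x ^ 2 + y ^ 2 = 1) :
    (((gegenbauer n).eval x : ℝ) : ℂ) = (2 / Real.pi : ℂ) * laplaceIntegral n x y := by
  have : (Real.pi : ℂ) ≠ 0 := by exact_mod_cast Real.pi_ne_zero
  rw [laplaceIntegral_eq n hxy]; field_simp

theorem norm_laplace_base_le {x y : ℝ} (hxy : x ^ 2 + y ^ 2 = 1) (θ : ℝ) :
    ‖(x : ℂ) + y * Real.cos θ * Complex.I‖ ≤ 1 := by
  have h : (x : ℂ) + y * Real.cos θ * Complex.I =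
      (x : ℂ) + ((y * Real.cos θ : ℝ) : ℂ) * Complex.I := by
    push_cast; ring
  rw [h, Complex.norm_add_mul_I, Real.sqrt_le_one]
  nlinarith [Real.cos_sq_le_one θ, sq_nonneg y]

theorem norm_integral_mul_sin_sq_le {f : ℝ → ℂ} {C : ℝ}
    (h : ∀ θ, ‖f θ‖ ≤ C) :
    ‖(2 / Real.pi : ℂ) * ∫ θ in (0 : ℝ)..Real.pi, f θ * (Real.sin θ : ℂ) ^ 2‖ ≤ C := by
  have h1 : ‖∫ θ in (0 : ℝ)..Real.pi, f θ * (Real.sin θ : ℂ) ^ 2‖ ≤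
      ∫ θ in (0 : ℝ)..Real.pi, C * Real.sin θ ^ 2 := by
    refine intervalIntegral.norm_integral_le_of_norm_le Real.pi_pos.le ?_
      (Continuous.intervalIntegrable (by fun_prop) _ _)
    filter_upwards with θ _
    rw [norm_mul, norm_pow, Complex.norm_real, Real.norm_eq_abs, sq_abs]
    gcongr
    exact h θ
  have h2 := integral_sin_sq (a := 0) (b := Real.pi)
  simp only [Real.sin_zero, Real.sin_pi, zero_mul, sub_self, sub_zero, zero_add] at h2
  rw [intervalIntegral.integral_const_mul, h2] at h1
  have h3 : ‖(2 / Real.pi : ℂ)‖ = 2 / Real.pi := by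
    rw [show (2 / Real.pi : ℂ) = ((2 / Real.pi : ℝ) : ℂ) by push_cast; rfl, Complex.norm_real,
      Real.norm_of_nonneg (by positivity)]
  rw [norm_mul, h3]
  calc _ ≤ 2 / Real.pi * (C * (Real.pi / 2)) := by gcongr
    _ = C := by field_simp

theorem abs_gegenbauer_le_one (n : ℕ) {x y : ℝ} (hxy : x ^ 2 + y ^ 2 = 1) :
    |(gegenbauer n).eval x| ≤ 1 := by
  rw [← Real.norm_eq_abs, ← Complex.norm_real, gegenbauer_eq_integral n hxy]
  refine norm_integral_mul_sin_sq_le fun θ => ?_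
  rw [norm_pow]
  exact pow_le_one₀ (norm_nonneg _) (norm_laplace_base_le hxy θ)

/-! ### The Bessel function `J₁` and the Mehler–Heine limit -/

theorem besselJ1_eq (x : ℝ) :
    besselJ1 x = x / Real.pi * ∫ θ in (0 : ℝ)..Real.pi,
      Real.cos (x * Real.cos θ) * Real.sin θ ^ 2 := by
  -- Poisson's integral from Bessel's: integrate the `sin τ sin (x sin τ)` half by parts, drop the
  -- other half by the symmetry `τ ↦ π - τ`, and shift by `π / 2` using periodicity.
  have h1 := intervalIntegral.integral_eq_sub_of_hasDerivAt (a := 0) (b := Real.pi)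
    (f := fun τ : ℝ => Real.cos τ * Real.sin (x * Real.sin τ))
    (f' := fun τ : ℝ => x * (Real.cos (x * Real.sin τ) * Real.cos τ ^ 2)
      - Real.sin τ * Real.sin (x * Real.sin τ))
    (fun τ _ => by
      refine ((Real.hasDerivAt_cos τ).mul
        (((Real.hasDerivAt_sin τ).const_mul x).sin)).congr_deriv ?_
      ring) (Continuous.intervalIntegrable (by fun_prop) _ _)
  have hodd : ∫ τ in (0 : ℝ)..Real.pi, Real.cos τ * Real.cos (x * Real.sin τ) = 0 := by
    have := intervalIntegral.integral_comp_sub_left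
      (fun τ => Real.cos τ * Real.cos (x * Real.sin τ)) Real.pi (a := 0) (b := Real.pi)
    simp only [Real.cos_pi_sub, Real.sin_pi_sub, sub_self, sub_zero, neg_mul,
      intervalIntegral.integral_neg] at this
    linarith
  have hshift : ∫ θ in (0 : ℝ)..Real.pi, Real.cos (x * Real.cos θ) * Real.sin θ ^ 2 =
      ∫ τ in (0 : ℝ)..Real.pi, Real.cos (x * Real.sin τ) * Real.cos τ ^ 2 := by
    have hper : Function.Periodic
        (fun τ => Real.cos (x * Real.sin τ) * Real.cos τ ^ 2) Real.pi := by
      intro τ; simp [Real.sin_add_pi, Real.cos_add_pi]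
    have h2 := hper.intervalIntegral_add_eq 0 (0 - Real.pi / 2)
    rw [zero_add] at h2
    rw [h2, show 0 - Real.pi / 2 + Real.pi = Real.pi - Real.pi / 2 by ring,
      ← intervalIntegral.integral_comp_sub_right
        (fun τ => Real.cos (x * Real.sin τ) * Real.cos τ ^ 2) (Real.pi / 2)]
    simp [Real.sin_sub_pi_div_two, Real.cos_sub_pi_div_two]
  rw [intervalIntegral.integral_sub (Continuous.intervalIntegrable (by fun_prop) _ _)
    (Continuous.intervalIntegrable (by fun_prop) _ _), intervalIntegral.integral_const_mul] at h1
  simp only [Real.sin_pi, Real.sin_zero, mul_zero, sub_self] at h1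
  simp only [besselJ1, Real.cos_sub]
  rw [intervalIntegral.integral_add (Continuous.intervalIntegrable (by fun_prop) _ _)
    (Continuous.intervalIntegrable (by fun_prop) _ _), hodd, hshift]
  linear_combination -(1 / Real.pi) * h1

theorem abs_besselJ1_le_one (x : ℝ) : |besselJ1 x| ≤ 1 := by
  have h := intervalIntegral.norm_integral_le_of_norm_le_const (a := 0) (b := Real.pi) (C := 1)
    (f := fun τ => Real.cos (τ - x * Real.sin τ)) (fun τ _ => Real.abs_cos_le_one _)
  rw [Real.norm_eq_abs, sub_zero, one_mul, abs_of_pos Real.pi_pos] at h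
  rw [besselJ1, abs_mul, abs_of_pos (by positivity : 0 < 1 / Real.pi)]
  calc _ ≤ 1 / Real.pi * Real.pi := by gcongr
    _ = 1 := by field_simp

theorem bddAbove_besselJ1_sq : BddAbove ((fun x => besselJ1 x ^ 2) '' Set.Ici 0) := by
  refine ⟨1, ?_⟩
  rintro _ ⟨x, -, rfl⟩
  exact (sq_le_one_iff_abs_le_one _).2 (abs_besselJ1_le_one x)

theorem besselJ1_sq_le {x : ℝ} (hx : 0 ≤ x) : besselJ1 x ^ 2 ≤ besselJ1SqSup :=
  le_csSup bddAbove_besselJ1_sq ⟨x, hx, rfl⟩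

theorem besselJ1_one_pos : 0 < besselJ1 1 := by
  rw [besselJ1_eq]
  refine mul_pos (by positivity) ?_
  refine intervalIntegral.intervalIntegral_pos_of_pos_on
    (Continuous.intervalIntegrable (by fun_prop) _ _) (fun θ hθ => ?_) Real.pi_pos
  have hs := Real.sin_pos_of_pos_of_lt_pi hθ.1 hθ.2
  have h1 := Real.abs_cos_le_one θ
  rw [abs_le] at h1
  have h2 : 0 < Real.cos (1 * Real.cos θ) := by
    have := Real.pi_gt_three
    apply Real.cos_pos_of_mem_Ioo
    constructor <;> linarith
  positivity

theorem besselJ1SqSup_pos : 0 < besselJ1SqSup :=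
  (pow_pos besselJ1_one_pos 2).trans_le (besselJ1_sq_le zero_le_one)

theorem norm_pow_sub_pow_le_of_norm_le_one {z w : ℂ} (hz : ‖z‖ ≤ 1) (hw : ‖w‖ ≤ 1) (n : ℕ) :
    ‖z ^ n - w ^ n‖ ≤ n * ‖z - w‖ := by
  induction n with
  | zero => simp
  | succ n ih =>
    have h : z ^ (n + 1) - w ^ (n + 1) = z ^ n * (z - w) + (z ^ n - w ^ n) * w := by ring
    rw [h]
    refine (norm_add_le _ _).trans ?_
    rw [norm_mul, norm_mul, norm_pow]
    have h1 : ‖z‖ ^ n ≤ 1 := pow_le_one₀ (norm_nonneg _) hz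
    have h2 := mul_le_mul h1 le_rfl (norm_nonneg (z - w)) zero_le_one
    have h3 := mul_le_mul ih hw (norm_nonneg w) (by positivity)
    push_cast
    linarith

/-- A quantitative Mehler–Heine formula. -/
theorem abs_gegenbauer_sub_besselJ1_le (n : ℕ) {s y : ℝ} (hs : 0 ≤ s) (hy : 0 ≤ y)
    (hsy : s ^ 2 + y ^ 2 = 1) :
    |n * y * (s ^ n * (gegenbauer n).eval s) - 2 * besselJ1 (n * y)| ≤ 3 * n ^ 2 * y ^ 3 := by
  have hy1 : y ≤ 1 := by nlinarith [sq_nonneg s]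
  have hs1 : s ≤ 1 := by nlinarith [sq_nonneg y]
  -- The factor `s ^ n` is absorbed in the base: with `t = y cos θ`, the base `s (s + i t)` equals
  -- `1 - y² + i s t`, which differs from `exp (i t)` by at most `3 y²`: one `y²` from `s² = 1 -
  -- y²`, one from `(s - 1) t`, one from the Taylor remainder. Both bases lie in the unit disc, so
  -- passing to `n`-th powers costs only a factor `n`.
  set f : ℝ → ℂ := fun θ => ((s : ℂ) * ((s : ℂ) + y * Real.cos θ * Complex.I)) ^ n
    - Complex.exp ((y * Real.cos θ : ℝ) * Complex.I) ^ n with hf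
  have hbound : ∀ θ, ‖f θ‖ ≤ n * (3 * y ^ 2) := by
    intro θ
    set t := y * Real.cos θ with ht
    have htabs : |t| ≤ y := by
      rw [ht, abs_mul, abs_of_nonneg hy]
      exact mul_le_of_le_one_right hy (Real.abs_cos_le_one θ)
    have hw : ‖Complex.exp (t * Complex.I)‖ ≤ 1 := (Complex.norm_exp_ofReal_mul_I t).le
    have hz : ‖(s : ℂ) * ((s : ℂ) + y * Real.cos θ * Complex.I)‖ ≤ 1 := by
      rw [norm_mul, Complex.norm_real, Real.norm_of_nonneg hs]
      exact mul_le_one₀ hs1 (norm_nonneg _) (norm_laplace_base_le hsy θ)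
    refine (norm_pow_sub_pow_le_of_norm_le_one hz hw n).trans ?_
    gcongr
    have hdec : (s : ℂ) * ((s : ℂ) + y * Real.cos θ * Complex.I) - Complex.exp (t * Complex.I) =
        ((-(y ^ 2) : ℝ) : ℂ) + ((s - 1) * t : ℝ) * Complex.I -
          (Complex.exp (t * Complex.I) - 1 - t * Complex.I) := by
      have : (s : ℂ) ^ 2 + y ^ 2 = 1 := by exact_mod_cast hsy
      rw [ht]; push_cast; linear_combination this
    have htn : ‖(t : ℂ) * Complex.I‖ = |t| := by simp
    have he := Complex.norm_exp_sub_one_sub_id_le (x := t * Complex.I) (by rw [htn]; linarith)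
    rw [htn, sq_abs] at he
    rw [hdec]
    refine (norm_sub_le _ _).trans ?_
    have h1 := norm_add_le ((-(y ^ 2) : ℝ) : ℂ) (((s - 1) * t : ℝ) * Complex.I)
    rw [norm_mul, Complex.norm_I, mul_one, Complex.norm_real, Complex.norm_real, norm_neg,
      Real.norm_of_nonneg (sq_nonneg y), Real.norm_eq_abs, abs_mul] at h1
    have h2 : |s - 1| ≤ y ^ 2 := by
      rw [abs_le]; constructor <;> nlinarith
    have h3 : |s - 1| * |t| ≤ y ^ 2 := by
      calc _ ≤ y ^ 2 * 1 := by gcongr; linarith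
        _ = _ := mul_one _
    have h4 : t ^ 2 ≤ y ^ 2 := sq_le_sq' (by linarith [(abs_le.1 htabs).1]) (abs_le.1 htabs).2
    linarith
  have hmain := norm_integral_mul_sin_sq_le hbound
  have hsplit : ∫ θ in (0 : ℝ)..Real.pi, f θ * (Real.sin θ : ℂ) ^ 2 =
      (s : ℂ) ^ n * laplaceIntegral n s y -
        ∫ θ in (0 : ℝ)..Real.pi, Complex.exp ((n * y * Real.cos θ : ℝ) * Complex.I) *
          (Real.sin θ : ℂ) ^ 2 := by
    rw [laplaceIntegral, ← intervalIntegral.integral_const_mul, ← intervalIntegral.integral_sub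
      (Continuous.intervalIntegrable (by fun_prop) _ _)
      (Continuous.intervalIntegrable (by fun_prop) _ _)]
    congr 1; ext θ
    simp only [hf, mul_pow, ← Complex.exp_nat_mul]
    push_cast
    ring_nf
  have hre : (∫ θ in (0 : ℝ)..Real.pi, Complex.exp ((n * y * Real.cos θ : ℝ) * Complex.I) *
      (Real.sin θ : ℂ) ^ 2).re =
      ∫ θ in (0 : ℝ)..Real.pi, Real.cos (n * y * Real.cos θ) * Real.sin θ ^ 2 := by
    have hcomm := Complex.reCLM.intervalIntegral_comp_comm (a := 0) (b := Real.pi) (μ := volume)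
      (f := fun θ : ℝ => Complex.exp ((n * y * Real.cos θ : ℝ) * Complex.I) *
        (Real.sin θ : ℂ) ^ 2) (Continuous.intervalIntegrable (by fun_prop) _ _)
    simp only [Complex.reCLM_apply] at hcomm
    rw [← hcomm]
    congr 1; ext θ
    rw [← Complex.ofReal_pow, Complex.re_mul_ofReal, Complex.exp_ofReal_mul_I_re]
  have hlap : (2 / Real.pi : ℂ) * (∫ θ in (0 : ℝ)..Real.pi, f θ * (Real.sin θ : ℂ) ^ 2) =
      ((s ^ n * (gegenbauer n).eval s : ℝ) : ℂ) - ((2 / Real.pi : ℝ) : ℂ) *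
        ∫ θ in (0 : ℝ)..Real.pi, Complex.exp ((n * y * Real.cos θ : ℝ) * Complex.I) *
          (Real.sin θ : ℂ) ^ 2 := by
    rw [hsplit]
    push_cast
    rw [gegenbauer_eq_integral n hsy]
    ring
  rw [hlap] at hmain
  have hfinal := (Complex.abs_re_le_norm _).trans hmain
  rw [Complex.sub_re, Complex.ofReal_re, Complex.re_ofReal_mul, hre] at hfinal
  have hb := besselJ1_eq (n * y)
  have hexp : n * y * (s ^ n * (gegenbauer n).eval s) - 2 * besselJ1 (n * y) =
      n * y * (s ^ n * (gegenbauer n).eval s - 2 / Real.pi *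
        ∫ θ in (0 : ℝ)..Real.pi, Real.cos (n * y * Real.cos θ) * Real.sin θ ^ 2) := by
    rw [hb]; ring
  rw [hexp, abs_mul, abs_of_nonneg (by positivity)]
  calc _ ≤ n * y * (n * (3 * y ^ 2)) := by gcongr
    _ = _ := by ring

/-! ### Sturm comparison and monotone energies in Liouville form -/

/-- A solution `g` of the equation with second derivative `-q g` has a zero in
every interval of length `π / m` on which `m² ≤ q`. -/
theorem exists_zero_of_sturm {g g1 q : ℝ → ℝ} {a m : ℝ} (hm : 0 < m)
    (hg : ∀ x ∈ Set.Icc a (a + Real.pi / m), HasDerivAt g (g1 x) x)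
    (hg1 : ∀ x ∈ Set.Icc a (a + Real.pi / m), HasDerivAt g1 (-q x * g x) x)
    (hq : ∀ x ∈ Set.Icc a (a + Real.pi / m), m ^ 2 ≤ q x) :
    ∃ x ∈ Set.Icc a (a + Real.pi / m), g x = 0 := by
  set b := a + Real.pi / m with hb
  have hab : a ≤ b := by
    have : 0 < Real.pi / m := by positivity
    linarith
  by_contra! hne
  have hcont : ContinuousOn g (Set.Icc a b) := fun x hx => (hg x hx).continuousAt.continuousWithinAt
  have hpos : (∀ x ∈ Set.Icc a b, 0 < g x * g a) := by
    intro x hx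
    by_contra! hle
    have hmem : (0 : ℝ) ∈ Set.uIcc (g a) (g x) := by
      rw [Set.mem_uIcc]
      rcases lt_or_gt_of_ne (hne a ⟨le_rfl, hab⟩) with h | h
      · left; exact ⟨h.le, by nlinarith⟩
      · right; exact ⟨by nlinarith, h.le⟩
    obtain ⟨z, hz, hz0⟩ := intermediate_value_uIcc (hcont.mono (by
      rw [Set.uIcc_of_le hx.1]; exact Set.Icc_subset_Icc_right hx.2)) hmem
    rw [Set.uIcc_of_le hx.1] at hz
    exact hne z ⟨hz.1, hz.2.trans hx.2⟩ hz0
  -- The Wronskian of `g` and `sin (m (x - a))`, multiplied by `g a` to fix the sign. If `g` had no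
  -- zero, `W` would be nonincreasing, yet `W a = -m g(a)² < 0 < m g(a) g(b) = W b`.
  set W : ℝ → ℝ := fun x =>
    g a * (g1 x * Real.sin (m * (x - a)) - m * g x * Real.cos (m * (x - a))) with hW
  have hWd : ∀ x ∈ Set.Icc a b,
      HasDerivAt W ((m ^ 2 - q x) * (g x * g a) * Real.sin (m * (x - a))) x := by
    intro x hx
    have hl : HasDerivAt (fun x => m * (x - a)) (m * 1) x :=
      ((hasDerivAt_id x).sub_const a).const_mul m
    refine ((((hg1 x hx).mul hl.sin).sub (((hg x hx).const_mul m).mul hl.cos)).const_mul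
      (g a)).congr_deriv ?_
    ring
  have hanti : AntitoneOn W (Set.Icc a b) := by
    refine antitoneOn_of_hasDerivWithinAt_nonpos (convex_Icc a b)
      (fun x hx => (hWd x hx).continuousAt.continuousWithinAt)
      (fun x hx => (hWd x (interior_subset hx)).hasDerivWithinAt) (fun x hx => ?_)
    have hx' := interior_subset hx
    have hs : 0 ≤ Real.sin (m * (x - a)) := by
      apply Real.sin_nonneg_of_nonneg_of_le_pi
      · exact mul_nonneg hm.le (by linarith [hx'.1])
      · have h1 : x - a ≤ Real.pi / m := by linarith [hx'.2]
        calc m * (x - a) ≤ m * (Real.pi / m) := by gcongr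
          _ = Real.pi := by field_simp
    exact mul_nonpos_of_nonpos_of_nonneg
      (mul_nonpos_of_nonpos_of_nonneg (by linarith [hq x hx']) (hpos x hx').le) hs
  have h := hanti ⟨le_rfl, hab⟩ ⟨hab, le_rfl⟩ hab
  have hmb : m * (b - a) = Real.pi := by rw [hb]; field_simp; ring
  simp only [hW, hmb, sub_self, mul_zero, Real.sin_pi, Real.sin_zero, Real.cos_pi,
    Real.cos_zero] at h
  have h1 := mul_pos hm (hpos a ⟨le_rfl, hab⟩)
  have h2 := mul_pos hm (hpos b ⟨hab, le_rfl⟩)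
  nlinarith

/-- The Gegenbauer polynomial in Liouville normal form. -/
noncomputable def liouville (n : ℕ) (φ : ℝ) : ℝ :=
  Real.sqrt (Real.sin φ) * (Real.sin φ * (gegenbauer n).eval (Real.cos φ))

/-- The derivative of `liouville n`. -/
noncomputable def liouvilleDeriv (n : ℕ) (φ : ℝ) : ℝ :=
  Real.sqrt (Real.sin φ) * (3 / 2 * Real.cos φ * (gegenbauer n).eval (Real.cos φ) -
    Real.sin φ ^ 2 * (gegenbauer n).derivative.eval (Real.cos φ))

/-- The potential of the differential equation solved by `liouville n`. -/
noncomputable def potential (n : ℕ) (φ : ℝ) : ℝ := (n + 3 / 2) ^ 2 - 3 / (4 * Real.sin φ ^ 2)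

theorem hasDerivAt_liouville (n : ℕ) {φ : ℝ} (hφ : 0 < Real.sin φ) :
    HasDerivAt (liouville n) (liouvilleDeriv n φ) φ := by
  have hs := Real.hasDerivAt_sin φ
  have hp := ((gegenbauer n).hasDerivAt (Real.cos φ)).comp φ (Real.hasDerivAt_cos φ)
  refine ((hs.sqrt hφ.ne').mul (hs.mul hp)).congr_deriv ?_
  simp only [Function.comp, liouvilleDeriv, Pi.mul_apply]
  have hr := Real.sq_sqrt hφ.le
  have hr0 : Real.sqrt (Real.sin φ) ≠ 0 := (Real.sqrt_pos.2 hφ).ne'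
  generalize Real.sqrt (Real.sin φ) = r at *
  rw [← hr]
  field_simp
  ring

theorem hasDerivAt_liouvilleDeriv (n : ℕ) {φ : ℝ} (hφ : 0 < Real.sin φ) :
    HasDerivAt (liouvilleDeriv n) (-potential n φ * liouville n φ) φ := by
  have hs := Real.hasDerivAt_sin φ
  have hc := Real.hasDerivAt_cos φ
  have hp := ((gegenbauer n).hasDerivAt (Real.cos φ)).comp φ hc
  have hp' := ((gegenbauer n).derivative.hasDerivAt (Real.cos φ)).comp φ hc
  refine ((hs.sqrt hφ.ne').mul (((hc.const_mul (3 / 2)).mul hp).sub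
    ((hs.pow 2).mul hp'))).congr_deriv ?_
  have hsc := Real.sin_sq_add_cos_sq φ
  have hode := gegenbauer_ode n (x := Real.cos φ) (by nlinarith)
  simp only [Function.comp, liouville, potential, Pi.mul_apply, Pi.sub_apply, Pi.pow_apply]
  have hr := Real.sq_sqrt hφ.le
  have hr0 : Real.sqrt (Real.sin φ) ≠ 0 := (Real.sqrt_pos.2 hφ).ne'
  generalize Real.sqrt (Real.sin φ) = r at *
  generalize Real.cos φ = c at *
  generalize Polynomial.eval c (gegenbauer n) = S at *
  generalize Polynomial.eval c (gegenbauer n).derivative = S1 at *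
  generalize Polynomial.eval c (gegenbauer n).derivative.derivative = S2 at *
  rw [← hr] at hsc ⊢
  field_simp
  push_cast
  linear_combination 16 * r ^ 4 * hode + (16 * r ^ 4 * S2 + 12 * S) * hsc

theorem hasDerivAt_potential (n : ℕ) {φ : ℝ} (hφ : 0 < Real.sin φ) :
    HasDerivAt (potential n) (3 / 2 * Real.cos φ / Real.sin φ ^ 3) φ := by
  have hs := (Real.hasDerivAt_sin φ).pow 2
  have h := ((hasDerivAt_const φ (3 : ℝ)).div (hs.const_mul 4) (by simp; exact hφ.ne')).const_sub
    ((n + 3 / 2 : ℝ) ^ 2)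
  refine h.congr_deriv ?_
  simp only [Pi.pow_apply]
  field_simp
  push_cast
  ring

/-- The energy at the equator `φ = π / 2`. -/
noncomputable def equatorEnergy (n : ℕ) : ℝ :=
  ((n + 3 / 2) ^ 2 - 3 / 4) * (gegenbauer n).eval 0 ^ 2 + (gegenbauer n).derivative.eval 0 ^ 2

theorem sin_pos_of_mem {φ ψ : ℝ} (hφ : 0 < φ) (hψ : ψ ∈ Set.Icc φ (Real.pi / 2)) :
    0 < Real.sin ψ :=
  Real.sin_pos_of_pos_of_lt_pi (hφ.trans_le hψ.1) (by linarith [hψ.2, Real.pi_pos])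

theorem cos_nonneg_of_mem {φ ψ : ℝ} (hφ : 0 < φ) (hψ : ψ ∈ Set.Icc φ (Real.pi / 2)) :
    0 ≤ Real.cos ψ :=
  Real.cos_nonneg_of_mem_Icc ⟨by linarith [hψ.1, Real.pi_pos], hψ.2⟩

/-- Sonin's argument: for `v'' = -q v`, the energy `q v² + v'²` has derivative `q' v²`, and `q`
increases up to the equator, where the energy is `equatorEnergy n`. -/
theorem potential_mul_sq_le (n : ℕ) {φ : ℝ} (hφ : 0 < φ) (hφ2 : φ ≤ Real.pi / 2) :
    potential n φ * liouville n φ ^ 2 ≤ equatorEnergy n := by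
  have hd : ∀ ψ ∈ Set.Icc φ (Real.pi / 2), HasDerivAt
      (fun ψ => potential n ψ * liouville n ψ ^ 2 + liouvilleDeriv n ψ ^ 2)
      (3 / 2 * Real.cos ψ / Real.sin ψ ^ 3 * liouville n ψ ^ 2) ψ := by
    intro ψ hψ
    have hs := sin_pos_of_mem hφ hψ
    refine (((hasDerivAt_potential n hs).mul ((hasDerivAt_liouville n hs).pow 2)).add
      ((hasDerivAt_liouvilleDeriv n hs).pow 2)).congr_deriv ?_
    simp only [Pi.pow_apply]
    push_cast
    ring
  have hmono := monotoneOn_of_hasDerivWithinAt_nonneg (convex_Icc φ (Real.pi / 2))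
    (fun ψ hψ => (hd ψ hψ).continuousAt.continuousWithinAt)
    (fun ψ hψ => (hd ψ (interior_subset hψ)).hasDerivWithinAt) (fun ψ hψ => by
      have hs := sin_pos_of_mem hφ (interior_subset hψ)
      have hc := cos_nonneg_of_mem hφ (interior_subset hψ)
      positivity)
  have h := hmono ⟨le_rfl, hφ2⟩ ⟨hφ2, le_rfl⟩ hφ2
  simp only [potential, liouville, liouvilleDeriv, Real.sin_pi_div_two, Real.cos_pi_div_two,
    Real.sqrt_one] at h
  simp only [potential, liouville, equatorEnergy]
  refine (le_add_of_nonneg_right (sq_nonneg _)).trans (h.trans (le_of_eq ?_))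
  ring

/-- The dual energy `v² + v'²/q` has derivative `-q' v'²/q² ≤ 0` and equals `v²` at a critical
point. So the envelope bound is nearly attained at each critical point, up to the ratio of `q` at
`φ` and at the equator. -/
theorem le_mul_sq_of_liouvilleDeriv_eq_zero (n : ℕ) {φ : ℝ} (hφ : 0 < φ) (hφ2 : φ ≤ Real.pi / 2)
    (hq : 0 < potential n φ) (h0 : liouvilleDeriv n φ = 0) :
    equatorEnergy n ≤ ((n + 3 / 2) ^ 2 - 3 / 4) * liouville n φ ^ 2 := by
  have hqpos : ∀ ψ ∈ Set.Icc φ (Real.pi / 2), 0 < potential n ψ := by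
    intro ψ hψ
    have hmono := monotoneOn_of_hasDerivWithinAt_nonneg (convex_Icc φ (Real.pi / 2))
      (fun ψ hψ => (hasDerivAt_potential n
        (sin_pos_of_mem hφ hψ)).continuousAt.continuousWithinAt)
      (fun ψ hψ => (hasDerivAt_potential n
        (sin_pos_of_mem hφ (interior_subset hψ))).hasDerivWithinAt) (fun ψ hψ => by
        have hs := sin_pos_of_mem hφ (interior_subset hψ)
        have hc := cos_nonneg_of_mem hφ (interior_subset hψ)
        positivity)
    exact hq.trans_le (hmono ⟨le_rfl, hφ2⟩ hψ hψ.1)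
  have hd : ∀ ψ ∈ Set.Icc φ (Real.pi / 2), HasDerivAt
      (fun ψ => liouville n ψ ^ 2 + liouvilleDeriv n ψ ^ 2 / potential n ψ)
      (-(3 / 2 * Real.cos ψ / Real.sin ψ ^ 3 * liouvilleDeriv n ψ ^ 2 / potential n ψ ^ 2)) ψ := by
    intro ψ hψ
    have hs := sin_pos_of_mem hφ hψ
    have hqψ := (hqpos ψ hψ).ne'
    refine (((hasDerivAt_liouville n hs).pow 2).add (((hasDerivAt_liouvilleDeriv n hs).pow 2).div
      (hasDerivAt_potential n hs) hqψ)).congr_deriv ?_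
    simp only [Pi.pow_apply]
    push_cast
    field_simp
    ring
  have hanti := antitoneOn_of_hasDerivWithinAt_nonpos (convex_Icc φ (Real.pi / 2))
    (fun ψ hψ => (hd ψ hψ).continuousAt.continuousWithinAt)
    (fun ψ hψ => (hd ψ (interior_subset hψ)).hasDerivWithinAt) (fun ψ hψ => by
      have hs := sin_pos_of_mem hφ (interior_subset hψ)
      have hc := cos_nonneg_of_mem hφ (interior_subset hψ)
      rw [neg_nonpos]
      positivity)
  have h := hanti ⟨le_rfl, hφ2⟩ ⟨hφ2, le_rfl⟩ hφ2
  have hc : (0 : ℝ) < (n + 3 / 2) ^ 2 - 3 / 4 := by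
    have : (0 : ℝ) ≤ n := n.cast_nonneg
    nlinarith
  have hqe : potential n (Real.pi / 2) = (n + 3 / 2) ^ 2 - 3 / 4 := by
    simp [potential]
  simp only [h0, hqe] at h
  simp only [liouville, liouvilleDeriv, Real.sin_pi_div_two, Real.cos_pi_div_two,
    Real.sqrt_one] at h
  have h2 := mul_le_mul_of_nonneg_left h hc.le
  refine le_of_eq_of_le ?_ (h2.trans (le_of_eq ?_))
  · rw [equatorEnergy, mul_add, mul_div_cancel₀ _ hc.ne']; ring
  · simp [liouville]

/-- With `N = n + 3/2`, the condition `N sin a ≥ 1` gives `q ≥ (N/2)²`, so every window of length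
`2π/N` contains a zero. The windows starting at `a` and `a + 3π/N` are disjoint and end by `a +
5π/N`; Rolle gives a critical point between their zeros. -/
theorem exists_liouvilleDeriv_eq_zero (n : ℕ) {a : ℝ} (ha : 0 < a)
    (hb : a + 5 * Real.pi / (n + 3 / 2) ≤ Real.pi / 2) (hsa : 1 ≤ (n + 3 / 2) * Real.sin a) :
    ∃ φ ∈ Set.Icc a (a + 5 * Real.pi / (n + 3 / 2)), liouvilleDeriv n φ = 0 ∧
      0 < potential n φ := by
  set N : ℝ := n + 3 / 2 with hN
  have hNpos : 0 < N := by positivity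
  have hpN : 0 < Real.pi / N := by positivity
  have h5 : 5 * Real.pi / N = 5 * (Real.pi / N) := by ring
  have hlen : Real.pi / (N / 2) = 2 * (Real.pi / N) := by field_simp
  rw [h5] at hb ⊢
  have hmem : ∀ x, a ≤ x → x ≤ a + 5 * (Real.pi / N) → x ∈ Set.Icc a (Real.pi / 2) :=
    fun x h1 h2 => ⟨h1, h2.trans hb⟩
  have hsin : ∀ x, a ≤ x → x ≤ a + 5 * (Real.pi / N) → 0 < Real.sin x :=
    fun x h1 h2 => sin_pos_of_mem ha (hmem x h1 h2)
  have hq : ∀ x, a ≤ x → x ≤ a + 5 * (Real.pi / N) → (N / 2) ^ 2 ≤ potential n x := by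
    intro x h1 h2
    have hs := hsin x h1 h2
    have hmono : Real.sin a ≤ Real.sin x :=
      Real.sin_le_sin_of_le_of_le_pi_div_two (by linarith [Real.pi_pos]) (hmem x h1 h2).2 h1
    have h3 : 1 ≤ N * Real.sin x := hsa.trans (by gcongr)
    have h4 : 3 / (4 * Real.sin x ^ 2) ≤ 3 / 4 * N ^ 2 := by
      rw [div_le_iff₀ (by positivity)]
      nlinarith
    rw [potential, ← hN]
    linarith
  obtain ⟨x, hx, hx0⟩ := exists_zero_of_sturm (g := liouville n) (g1 := liouvilleDeriv n)
    (q := potential n) (a := a) (m := N / 2) (by positivity)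
    (fun x hx => hasDerivAt_liouville n (hsin x hx.1 (by linarith [hx.2, hlen])))
    (fun x hx => hasDerivAt_liouvilleDeriv n (hsin x hx.1 (by linarith [hx.2, hlen])))
    (fun x hx => hq x hx.1 (by linarith [hx.2, hlen]))
  obtain ⟨y, hy, hy0⟩ := exists_zero_of_sturm (g := liouville n) (g1 := liouvilleDeriv n)
    (q := potential n) (a := a + 3 * (Real.pi / N)) (m := N / 2) (by positivity)
    (fun x hx => hasDerivAt_liouville n
      (hsin x (by linarith [hx.1]) (by linarith [hx.2, hlen])))
    (fun x hx => hasDerivAt_liouvilleDeriv n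
      (hsin x (by linarith [hx.1]) (by linarith [hx.2, hlen])))
    (fun x hx => hq x (by linarith [hx.1]) (by linarith [hx.2, hlen]))
  rw [hlen] at hx hy
  have hxy : x < y := by linarith [hx.2, hy.1]
  have hd : ∀ z ∈ Set.Icc x y, HasDerivAt (liouville n) (liouvilleDeriv n z) z := fun z hz =>
    hasDerivAt_liouville n (hsin z (by linarith [hx.1, hz.1]) (by linarith [hy.2, hz.2]))
  obtain ⟨φ, hφ, hφ0⟩ := exists_hasDerivAt_eq_zero hxy
    (fun z hz => (hd z hz).continuousAt.continuousWithinAt) (hx0.trans hy0.symm)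
    (fun z hz => hd z (Set.Ioo_subset_Icc_self hz))
  have hφ1 : a ≤ φ := by linarith [hx.1, hφ.1]
  have hφ2 : φ ≤ a + 5 * (Real.pi / N) := by linarith [hy.2, hφ.2]
  exact ⟨φ, ⟨hφ1, hφ2⟩, hφ0, lt_of_lt_of_le (by positivity) (hq φ hφ1 hφ2)⟩

/-! ### Equator values and Wallis' product -/

theorem gegenbauer_odd_eval_zero (m : ℕ) : (gegenbauer (2 * m + 1)).eval 0 = 0 := by
  induction m with
  | zero => simp [gegenbauer]
  | succ m ih =>
    have h := gegenbauer_recurrence (2 * m + 1) 0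
    rw [ih] at h
    simp only [mul_zero, zero_mul, sub_self, mul_eq_zero] at h
    rcases h with h | h
    · exact absurd h (by positivity)
    · exact h

/-- At `x = 0` the recurrence has two terms, with ratio `-(2m+1)/(2m+4)`; its square cancels the
growth of the Wallis product and of the rational factor. -/
theorem gegenbauer_even_eval_zero_sq (m : ℕ) :
    (gegenbauer (2 * m)).eval 0 ^ 2 * (Real.Wallis.W m * (2 * m + 1) * (m + 1) ^ 2) = 1 := by
  induction m with
  | zero => simp [gegenbauer, Real.Wallis.W]
  | succ m ih =>
    have h := gegenbauer_recurrence (2 * m) 0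
    push_cast at h
    have h2 : (gegenbauer (2 * (m + 1))).eval 0 =
        -((2 * m + 1) / (2 * m + 4)) * (gegenbauer (2 * m)).eval 0 := by
      rw [show 2 * (m + 1) = 2 * m + 2 by ring]
      have h4 : (2 * m + 4 : ℝ) ≠ 0 := by positivity
      field_simp
      linear_combination h
    refine Eq.trans ?_ ih
    rw [h2, Real.Wallis.W_succ]
    push_cast
    field_simp
    ring

/-- For even `n` the derivative vanishes at `0`, for odd `n` the value does. Either way the product
is an explicit rational function tending to `4`; the bounds cover both parities, and `W → π/2` then
gives the constant `8/π`. -/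
theorem equatorEnergy_bounds (n : ℕ) :
    4 * n / (n + 2) ≤ (n + 1) * equatorEnergy n * Real.Wallis.W (n / 2) ∧
      (n + 1) * equatorEnergy n * Real.Wallis.W (n / 2) ≤ 4 := by
  rcases Nat.even_or_odd' n with ⟨m, rfl | rfl⟩
  · have h1 : (gegenbauer (2 * m)).derivative.eval 0 = 0 := by
      have := (one_sub_sq_mul_derivative_gegenbauer (2 * m) 0).2
      simpa [gegenbauer_odd_eval_zero] using this
    have h2 := gegenbauer_even_eval_zero_sq m
    have hW := Real.Wallis.W_pos m
    have h3 : ((2 * m : ℕ) + 1) * equatorEnergy (2 * m) * Real.Wallis.W (2 * m / 2) =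
        ((2 * m + 3 / 2) ^ 2 - 3 / 4) / (m + 1) ^ 2 := by
      rw [equatorEnergy, h1, show 2 * m / 2 = m by omega]
      push_cast
      field_simp
      linear_combination (4 * (4 * m + 3 : ℝ) ^ 2 - 12) * h2
    rw [h3]
    push_cast
    constructor
    · rw [div_le_div_iff₀ (by positivity) (by positivity)]
      nlinarith [(m.cast_nonneg : (0 : ℝ) ≤ m), sq_nonneg (m : ℝ)]
    · rw [div_le_iff₀ (by positivity)]
      nlinarith [(m.cast_nonneg : (0 : ℝ) ≤ m)]
  · have h1 : (gegenbauer (2 * m + 1)).derivative.eval 0 =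
        (2 * m + 1) * (gegenbauer (2 * m)).eval 0 := by
      have := (one_sub_sq_mul_derivative_gegenbauer (2 * m) 0).1
      simpa using this
    have h2 := gegenbauer_even_eval_zero_sq m
    have hW := Real.Wallis.W_pos m
    have h3 : ((2 * m + 1 : ℕ) + 1) * equatorEnergy (2 * m + 1) *
        Real.Wallis.W ((2 * m + 1) / 2) = 2 * (2 * m + 1) / (m + 1) := by
      rw [equatorEnergy, h1, gegenbauer_odd_eval_zero, show (2 * m + 1) / 2 = m by omega]
      push_cast
      field_simp
      linear_combination (32 * (2 * m + 1 : ℝ)) * h2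
    rw [h3]
    push_cast
    constructor
    · rw [div_le_div_iff₀ (by positivity) (by positivity)]
      nlinarith [(m.cast_nonneg : (0 : ℝ) ≤ m)]
    · rw [div_le_iff₀ (by positivity)]
      nlinarith [(m.cast_nonneg : (0 : ℝ) ≤ m)]

theorem tendsto_mul_equatorEnergy :
    Tendsto (fun n : ℕ => (n + 1) * equatorEnergy n) atTop (𝓝 (8 / Real.pi)) := by
  have hW : Tendsto (fun n : ℕ => Real.Wallis.W (n / 2)) atTop (𝓝 (Real.pi / 2)) :=
    Real.Wallis.tendsto_W_nhds_pi_div_two.comp (Nat.tendsto_div_const_atTop two_ne_zero)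
  have h4 : Tendsto (fun n : ℕ => 4 * n / (n + 2 : ℝ)) atTop (𝓝 4) := by
    have h := (tendsto_natCast_div_add_atTop (2 : ℝ)).const_mul 4
    rw [mul_one] at h
    exact h.congr fun n => by ring
  have h := tendsto_of_tendsto_of_tendsto_of_le_of_le h4 tendsto_const_nhds
    (fun n => (equatorEnergy_bounds n).1) (fun n => (equatorEnergy_bounds n).2)
  have h5 := h.div hW (by positivity)
  rw [show (4 : ℝ) / (Real.pi / 2) = 8 / Real.pi by field_simp; norm_num] at h5
  refine h5.congr fun n => ?_
  have := (Real.Wallis.W_pos (n / 2)).ne'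
  simp only [Pi.div_apply]
  field_simp

/-! ### Nesterov residual polynomials and their uniform bounds -/

/-- The polynomials in `H / λ⁺` which take the initial gradient to the gradients at the Nesterov
iterates `x_k` and `y_k`. -/
noncomputable def nesterovPoly : ℕ → Polynomial ℝ × Polynomial ℝ
  | 0 => (1, 1)
  | k + 1 =>
    ((1 - Polynomial.X) * (nesterovPoly k).2,
      (1 - Polynomial.X) * (nesterovPoly k).2 + Polynomial.C ((k : ℝ) / (k + 3)) *
        ((1 - Polynomial.X) * (nesterovPoly k).2 - (nesterovPoly k).1))

/-- The residual polynomial of the Nesterov iterate `x_k`, as a function. -/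
noncomputable def residual (k : ℕ) (u : ℝ) : ℝ := (nesterovPoly k).1.eval u

theorem continuous_residual (k : ℕ) : Continuous (residual k) := (nesterovPoly k).1.continuous

theorem residual_succ_succ (k : ℕ) (u : ℝ) :
    residual (k + 2) u = (1 - u) * (residual (k + 1) u +
      (k / (k + 3)) * (residual (k + 1) u - residual k u)) := by
  simp [residual, nesterovPoly]

/-- With `1 - u = s²` and `k = n + 1`, the momentum weight `k/(k+3)` produces the coefficients
`(2n+5)/(n+4)` and `(n+1)/(n+4)` of the Gegenbauer recurrence. The identification starts at `x₁`:
the weight vanishes at `k = 0`, so the residual of `x₀` drops out. -/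
theorem residual_succ_eq (n : ℕ) (s : ℝ) :
    residual (n + 1) (1 - s ^ 2) = s ^ (n + 2) * (gegenbauer n).eval s := by
  induction n using Nat.twoStepInduction with
  | zero => simp [residual, nesterovPoly, gegenbauer]
  | one => rw [residual_succ_succ]; simp [residual, nesterovPoly, gegenbauer]; ring
  | more n ih0 ih1 =>
    rw [residual_succ_succ, ih1, ih0]
    have h := gegenbauer_recurrence n s
    have h4 : (n + 4 : ℝ) ≠ 0 := by positivity
    have h4' : (n + 1 + 3 : ℝ) ≠ 0 := by positivity
    apply mul_left_cancel₀ h4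
    push_cast
    field_simp
    linear_combination -s ^ (n + 4) * h

theorem gegenbauer_energy_le (n : ℕ) {s y : ℝ} (hs : 0 ≤ s) (hy : 0 < y)
    (hsy : s ^ 2 + y ^ 2 = 1) :
    ((n + 3 / 2) ^ 2 - 3 / (4 * y ^ 2)) * (y ^ 3 * (gegenbauer n).eval s ^ 2) ≤
      equatorEnergy n := by
  have hy1 : y ≤ 1 := by nlinarith [sq_nonneg s]
  have hsin : Real.sin (Real.arcsin y) = y := Real.sin_arcsin (by linarith) hy1
  have hcos : Real.cos (Real.arcsin y) = s := by
    rw [Real.cos_arcsin, show 1 - y ^ 2 = s ^ 2 by linarith, Real.sqrt_sq hs]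
  have h := potential_mul_sq_le n (Real.arcsin_pos.2 hy) (Real.arcsin_le_pi_div_two y)
  rw [potential, liouville, hsin, hcos, mul_pow, Real.sq_sqrt hy.le] at h
  refine le_of_eq_of_le ?_ h
  ring

/-- Compare with the Gaussian `y exp (-τ² y²)`, maximal at `y = 1/(√2 τ)`. With `z = √2 τ y`, this
is `z ≤ (z² + 1)/2 ≤ exp ((z² - 1)/2)`. -/
theorem mul_one_sub_sq_pow_le {y τ : ℝ} {m : ℕ} (hy : 0 ≤ y) (hy1 : y ≤ 1) (hτ : 0 < τ)
    (hm : τ ^ 2 ≤ m) :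
    y * (1 - y ^ 2) ^ m ≤ Real.exp (-(1 / 2)) / (Real.sqrt 2 * τ) := by
  have h1 : (1 - y ^ 2) ^ m ≤ Real.exp (-(τ ^ 2 * y ^ 2)) := by
    calc (1 - y ^ 2) ^ m ≤ Real.exp (-(y ^ 2)) ^ m := by
          gcongr
          · nlinarith
          · linarith [Real.add_one_le_exp (-(y ^ 2))]
      _ = Real.exp (-(m * y ^ 2)) := by rw [← Real.exp_nat_mul]; ring_nf
      _ ≤ _ := by gcongr
  have h2 : Real.sqrt 2 * τ * y ≤ Real.exp (τ ^ 2 * y ^ 2 - 1 / 2) := by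
    have h3 := Real.add_one_le_exp (τ ^ 2 * y ^ 2 - 1 / 2)
    have h4 : (Real.sqrt 2 * τ * y) ^ 2 = 2 * (τ ^ 2 * y ^ 2) := by
      rw [mul_pow, mul_pow, Real.sq_sqrt (by norm_num)]; ring
    nlinarith [sq_nonneg (Real.sqrt 2 * τ * y - 1)]
  rw [le_div_iff₀ (by positivity)]
  calc y * (1 - y ^ 2) ^ m * (Real.sqrt 2 * τ) = Real.sqrt 2 * τ * y * (1 - y ^ 2) ^ m := by ring
    _ ≤ Real.exp (τ ^ 2 * y ^ 2 - 1 / 2) * Real.exp (-(τ ^ 2 * y ^ 2)) := by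
      apply mul_le_mul h2 h1 _ (Real.exp_pos _).le
      exact pow_nonneg (by nlinarith) _
    _ = _ := by rw [← Real.exp_add]; ring_nf

theorem exists_sq_add_sq {u : ℝ} (hu : u ∈ Set.Icc (0 : ℝ) 1) :
    ∃ s y : ℝ, 0 ≤ s ∧ 0 ≤ y ∧ s ^ 2 + y ^ 2 = 1 ∧ u = y ^ 2 := by
  refine ⟨Real.sqrt (1 - u), Real.sqrt u, Real.sqrt_nonneg _, Real.sqrt_nonneg _, ?_, ?_⟩
  · rw [Real.sq_sqrt hu.1, Real.sq_sqrt (by linarith [hu.2])]; ring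
  · rw [Real.sq_sqrt hu.1]

/-- The eighth root `t` makes all powers integral: `t ^ 28 = (n + 1) ^ (7/2)`. For `y² ≤ t ^ (-15)`
the trivial bound `|p| ≤ 1` suffices. Above that, `3/(4y²)` is at most `(3/4) t ^ 15`, of lower
order than `t ^ 16`, and the quantity splits as `y (1 - y²)^(n+2)` times `y³ G²`, one bounded by the
Gaussian estimate and the other by the energy. -/
theorem sq_mul_residual_sq_le (n : ℕ) {t u : ℝ} (ht : 1 < t) (htn : t ^ 8 = n + 1)
    (hu : u ∈ Set.Icc (0 : ℝ) 1) :
    t ^ 28 * (u ^ 2 * residual (n + 1) u ^ 2) ≤ max (1 / t ^ 2)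
      (Real.exp (-(1 / 2)) / Real.sqrt 2 * ((n + 1) * equatorEnergy n) / (1 - 3 / (4 * t))) := by
  obtain ⟨s, y, hs, hy, hsy, rfl⟩ := exists_sq_add_sq hu
  have hs1 : s ≤ 1 := by nlinarith [sq_nonneg y]
  have hy1 : y ≤ 1 := by nlinarith [sq_nonneg s]
  have hS : (gegenbauer n).eval s ^ 2 ≤ 1 :=
    (sq_le_one_iff_abs_le_one _).2 (abs_gegenbauer_le_one n hsy)
  have hres : residual (n + 1) (y ^ 2) = s ^ (n + 2) * (gegenbauer n).eval s := by
    rw [← residual_succ_eq]; congr 1; linarith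
  have hsn : s ^ (n + 2) ≤ 1 := pow_le_one₀ hs hs1
  have hsn0 : 0 ≤ s ^ (n + 2) := pow_nonneg hs _
  have ht0 : 0 < t := by linarith
  rw [hres]
  rcases le_or_gt (y ^ 2) (1 / t ^ 15) with h | h
  · refine le_max_of_le_left ?_
    have h1 : (s ^ (n + 2) * (gegenbauer n).eval s) ^ 2 ≤ 1 := by
      rw [mul_pow]
      exact mul_le_one₀ (pow_le_one₀ hsn0 hsn) (sq_nonneg _) hS
    calc t ^ 28 * ((y ^ 2) ^ 2 * (s ^ (n + 2) * (gegenbauer n).eval s) ^ 2)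
        ≤ t ^ 28 * ((1 / t ^ 15) ^ 2 * 1) := by gcongr
      _ = 1 / t ^ 2 := by field_simp
  · refine le_max_of_le_right ?_
    have hy0 : 0 < y := by
      rcases hy.eq_or_lt with h0 | h0
      · rw [← h0] at h
        have : 0 < 1 / t ^ 15 := by positivity
        linarith
      · exact h0
    have hden : 0 < 1 - 3 / (4 * t) := by
      rw [sub_pos, div_lt_one (by positivity)]; linarith
    have hQ : t ^ 16 * (1 - 3 / (4 * t)) ≤ (n + 3 / 2) ^ 2 - 3 / (4 * y ^ 2) := by
      have h1 : t ^ 16 ≤ (n + 3 / 2 : ℝ) ^ 2 := by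
        rw [show t ^ 16 = (t ^ 8) ^ 2 by ring, htn]; gcongr; norm_num
      have h2 : 3 / (4 * y ^ 2) ≤ 3 / 4 * t ^ 15 := by
        rw [div_lt_iff₀ (by positivity)] at h
        rw [div_le_iff₀ (by positivity)]
        nlinarith
      have h3 : t ^ 16 * (1 - 3 / (4 * t)) = t ^ 16 - 3 / 4 * t ^ 15 := by field_simp
      linarith
    have hE : y ^ 3 * (gegenbauer n).eval s ^ 2 ≤
        equatorEnergy n / (t ^ 16 * (1 - 3 / (4 * t))) := by
      rw [le_div_iff₀ (by positivity), mul_comm]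
      exact (mul_le_mul_of_nonneg_right hQ (by positivity)).trans
        (gegenbauer_energy_le n hs hy0 hsy)
    have hexp : y * (1 - y ^ 2) ^ (n + 2) ≤ Real.exp (-(1 / 2)) / (Real.sqrt 2 * t ^ 4) := by
      refine mul_one_sub_sq_pow_le hy hy1 (by positivity) ?_
      rw [show (t ^ 4) ^ 2 = t ^ 8 by ring, htn]
      push_cast
      linarith
    calc t ^ 28 * ((y ^ 2) ^ 2 * (s ^ (n + 2) * (gegenbauer n).eval s) ^ 2)
        = t ^ 28 * ((y * (1 - y ^ 2) ^ (n + 2)) * (y ^ 3 * (gegenbauer n).eval s ^ 2)) := by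
          rw [show 1 - y ^ 2 = s ^ 2 by linarith]; ring
      _ ≤ t ^ 28 * ((Real.exp (-(1 / 2)) / (Real.sqrt 2 * t ^ 4)) *
          (equatorEnergy n / (t ^ 16 * (1 - 3 / (4 * t))))) := by gcongr
      _ = Real.exp (-(1 / 2)) / Real.sqrt 2 * (t ^ 8 * equatorEnergy n) / (1 - 3 / (4 * t)) := by
          generalize 1 - 3 / (4 * t) = D at *
          field_simp
      _ = _ := by rw [htn]

/-- The threshold `y = t ^ (-7)`, that is `(n + 1) ^ (-7/8)`, makes both regimes work: below it the
Mehler–Heine error `3 n² y³` is at most `3 / t ^ 5`, and replacing `n` by `n + 1` costs `1 / t ^ 7`;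
above it `1 < y t ^ 7` supplies the missing power of `y` for the energy bound and still leaves a
gain `1 / t`. -/
theorem mul_residual_sq_le (n : ℕ) {t u : ℝ} (ht : 1 < t) (htn : t ^ 8 = n + 1)
    (hu : u ∈ Set.Icc (0 : ℝ) 1) :
    t ^ 16 * (u * residual (n + 1) u ^ 2) ≤
      max ((2 * Real.sqrt besselJ1SqSup + (3 / t ^ 5 + 1 / t ^ 7)) ^ 2)
        ((n + 1) * equatorEnergy n / (t * (1 - 3 / (4 * t ^ 2)))) := by
  obtain ⟨s, y, hs, hy, hsy, rfl⟩ := exists_sq_add_sq hu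
  have hs1 : s ≤ 1 := by nlinarith [sq_nonneg y]
  have hSabs := abs_gegenbauer_le_one n hsy
  have hres : residual (n + 1) (y ^ 2) = s ^ (n + 2) * (gegenbauer n).eval s := by
    rw [← residual_succ_eq]; congr 1; linarith
  have hsn : s ^ n ≤ 1 := pow_le_one₀ hs hs1
  have hsn0 : 0 ≤ s ^ n := pow_nonneg hs _
  have hsn2 : s ^ (n + 2) ≤ 1 := pow_le_one₀ hs hs1
  have hsn20 : 0 ≤ s ^ (n + 2) := pow_nonneg hs _
  have ht0 : 0 < t := by linarith
  rw [hres]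
  rcases le_or_gt y (1 / t ^ 7) with h | h
  · refine le_max_of_le_left ?_
    have hJ : |besselJ1 (n * y)| ≤ Real.sqrt besselJ1SqSup :=
      Real.abs_le_sqrt (besselJ1_sq_le (by positivity))
    have hMH := abs_gegenbauer_sub_besselJ1_le n hs hy hsy
    have h1 : 3 * (n : ℝ) ^ 2 * y ^ 3 ≤ 3 / t ^ 5 := by
      calc 3 * (n : ℝ) ^ 2 * y ^ 3 ≤ 3 * (t ^ 8) ^ 2 * (1 / t ^ 7) ^ 3 := by
            gcongr; linarith
        _ = 3 / t ^ 5 := by field_simp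
    have h2 : |n * y * (s ^ n * (gegenbauer n).eval s)| ≤
        2 * Real.sqrt besselJ1SqSup + 3 / t ^ 5 := by
      have h3 := abs_sub_abs_le_abs_sub (n * y * (s ^ n * (gegenbauer n).eval s))
        (2 * besselJ1 (n * y))
      rw [abs_mul 2, abs_two] at h3
      linarith
    have h4 : |s ^ n * (gegenbauer n).eval s| ≤ 1 := by
      rw [abs_mul, abs_of_nonneg hsn0]
      exact mul_le_one₀ hsn (abs_nonneg _) hSabs
    have h5 : |t ^ 8 * y * (s ^ (n + 2) * (gegenbauer n).eval s)| ≤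
        2 * Real.sqrt besselJ1SqSup + (3 / t ^ 5 + 1 / t ^ 7) := by
      have h6 : t ^ 8 * y * (s ^ (n + 2) * (gegenbauer n).eval s) =
          s ^ 2 * (n * y * (s ^ n * (gegenbauer n).eval s) +
            y * (s ^ n * (gegenbauer n).eval s)) := by rw [htn]; ring
      rw [h6, abs_mul, abs_of_nonneg (sq_nonneg s)]
      have h7 := abs_add_le (n * y * (s ^ n * (gegenbauer n).eval s))
        (y * (s ^ n * (gegenbauer n).eval s))
      have h8 : |y * (s ^ n * (gegenbauer n).eval s)| ≤ 1 / t ^ 7 := by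
        rw [abs_mul, abs_of_nonneg hy]
        exact (mul_le_of_le_one_right hy h4).trans h
      refine (mul_le_of_le_one_left (abs_nonneg _) (pow_le_one₀ hs hs1)).trans ?_
      linarith
    calc t ^ 16 * (y ^ 2 * (s ^ (n + 2) * (gegenbauer n).eval s) ^ 2)
        = |t ^ 8 * y * (s ^ (n + 2) * (gegenbauer n).eval s)| ^ 2 := by rw [sq_abs]; ring
      _ ≤ _ := by gcongr
  · refine le_max_of_le_right ?_
    have hy0 : 0 < y := lt_trans (by positivity) h
    have hden : 0 < 1 - 3 / (4 * t ^ 2) := by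
      rw [sub_pos, div_lt_one (by positivity)]; nlinarith
    have hy7 : 1 < y * t ^ 7 := by rwa [div_lt_iff₀ (by positivity)] at h
    have hQ : t ^ 16 * (1 - 3 / (4 * t ^ 2)) ≤ (n + 3 / 2) ^ 2 - 3 / (4 * y ^ 2) := by
      have h1 : t ^ 16 ≤ (n + 3 / 2 : ℝ) ^ 2 := by
        rw [show t ^ 16 = (t ^ 8) ^ 2 by ring, htn]; gcongr; norm_num
      have h2 : 3 / (4 * y ^ 2) ≤ 3 / 4 * t ^ 14 := by
        rw [div_le_iff₀ (by positivity)]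
        nlinarith
      have h3 : t ^ 16 * (1 - 3 / (4 * t ^ 2)) = t ^ 16 - 3 / 4 * t ^ 14 := by field_simp
      linarith
    have hE : y ^ 3 * (gegenbauer n).eval s ^ 2 ≤
        equatorEnergy n / (t ^ 16 * (1 - 3 / (4 * t ^ 2))) := by
      rw [le_div_iff₀ (by positivity), mul_comm]
      exact (mul_le_mul_of_nonneg_right hQ (by positivity)).trans
        (gegenbauer_energy_le n hs hy0 hsy)
    calc t ^ 16 * (y ^ 2 * (s ^ (n + 2) * (gegenbauer n).eval s) ^ 2)
        = t ^ 16 * (y ^ 2 * (gegenbauer n).eval s ^ 2) * (s ^ (n + 2)) ^ 2 := by ring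
      _ ≤ t ^ 16 * (y ^ 2 * (gegenbauer n).eval s ^ 2) * 1 := by
          gcongr; exact pow_le_one₀ hsn20 hsn2
      _ ≤ t ^ 16 * (y ^ 2 * (gegenbauer n).eval s ^ 2) * (y * t ^ 7) := by
          gcongr
      _ = t ^ 16 * (t ^ 7 * (y ^ 3 * (gegenbauer n).eval s ^ 2)) := by ring
      _ ≤ t ^ 16 * (t ^ 7 * (equatorEnergy n / (t ^ 16 * (1 - 3 / (4 * t ^ 2))))) := by gcongr
      _ = t ^ 8 * equatorEnergy n / (t * (1 - 3 / (4 * t ^ 2))) := by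
          generalize 1 - 3 / (4 * t ^ 2) = D at *
          field_simp
      _ = _ := by rw [htn]

/-! ### Asymptotics of the two suprema -/

/-- The largest value of `u p_k(u)²` on `[0, 1]`. -/
noncomputable def noiseSup (k : ℕ) : ℝ :=
  sSup ((fun u => u * residual k u ^ 2) '' Set.Icc 0 1)

/-- The largest value of `u² p_k(u)²` on `[0, 1]`. -/
noncomputable def signalSup (k : ℕ) : ℝ :=
  sSup ((fun u => u ^ 2 * residual k u ^ 2) '' Set.Icc 0 1)

theorem le_noiseSup (k : ℕ) {u : ℝ} (hu : u ∈ Set.Icc (0 : ℝ) 1) :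
    u * residual k u ^ 2 ≤ noiseSup k :=
  le_csSup (isCompact_Icc.bddAbove_image (by have := continuous_residual k; fun_prop))
    ⟨u, hu, rfl⟩

theorem le_signalSup (k : ℕ) {u : ℝ} (hu : u ∈ Set.Icc (0 : ℝ) 1) :
    u ^ 2 * residual k u ^ 2 ≤ signalSup k :=
  le_csSup (isCompact_Icc.bddAbove_image (by have := continuous_residual k; fun_prop))
    ⟨u, hu, rfl⟩

/-- The eighth root of `n + 1`. -/
noncomputable def eighthRoot (n : ℕ) : ℝ := (n + 1 : ℝ) ^ (1 / 8 : ℝ)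

theorem eighthRoot_pow (n : ℕ) : eighthRoot n ^ 8 = n + 1 := by
  rw [eighthRoot, ← Real.rpow_natCast, ← Real.rpow_mul (by positivity)]; norm_num

theorem tendsto_eighthRoot : Tendsto eighthRoot atTop atTop :=
  (tendsto_rpow_atTop (by norm_num : (0 : ℝ) < 1 / 8)).comp
    (tendsto_atTop_add_const_right _ 1 tendsto_natCast_atTop_atTop)

theorem tendsto_div_eighthRoot_pow (c : ℝ) {m : ℕ} (hm : m ≠ 0) :
    Tendsto (fun n => c / eighthRoot n ^ m) atTop (𝓝 0) :=
  ((tendsto_pow_atTop hm).comp tendsto_eighthRoot).const_div_atTop c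

theorem tendsto_mul_residual_sq {x : ℝ} (hx : 0 ≤ x) :
    Tendsto (fun n : ℕ => (n + 1 : ℝ) ^ 2 * ((x / n) ^ 2 * residual (n + 1) ((x / n) ^ 2) ^ 2))
      atTop (𝓝 (4 * besselJ1 x ^ 2)) := by
  have hxn : Tendsto (fun n : ℕ => x / (n : ℝ)) atTop (𝓝 0) :=
    tendsto_const_div_atTop_nhds_zero_nat x
  set s : ℕ → ℝ := fun n => Real.sqrt (1 - (x / n) ^ 2) with hs
  have hs1 : Tendsto (fun n => s n ^ 2) atTop (𝓝 1) := by
    have h := (Real.continuous_sqrt.tendsto _).comp ((hxn.pow 2).const_sub 1)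
    have h' := h.pow 2
    simpa using h'
  have hev : ∀ᶠ n : ℕ in atTop, n ≠ 0 ∧ x / (n : ℝ) ≤ 1 := by
    filter_upwards [eventually_ne_atTop 0, hxn.eventually_le_const one_pos] with n h1 h2
    exact ⟨h1, h2⟩
  have hs2 : ∀ n : ℕ, x / (n : ℝ) ≤ 1 → s n ^ 2 + (x / n) ^ 2 = 1 := by
    intro n hn
    have : (x / (n : ℝ)) ^ 2 ≤ 1 := pow_le_one₀ (by positivity) hn
    simp only [hs]
    rw [Real.sq_sqrt (by linarith)]; ring
  have hMH : Tendsto (fun n : ℕ => x * (s n ^ n * (gegenbauer n).eval (s n))) atTop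
      (𝓝 (2 * besselJ1 x)) := by
    rw [tendsto_iff_dist_tendsto_zero]
    refine squeeze_zero' (Eventually.of_forall fun _ => dist_nonneg) ?_
      (tendsto_const_div_atTop_nhds_zero_nat (3 * x ^ 3))
    filter_upwards [hev] with n hn
    have hn0 : (n : ℝ) ≠ 0 := by exact_mod_cast hn.1
    have h := abs_gegenbauer_sub_besselJ1_le n (Real.sqrt_nonneg (1 - (x / n) ^ 2))
      (by positivity : 0 ≤ x / (n : ℝ)) (hs2 n hn.2)
    rw [mul_div_cancel₀ _ hn0] at h
    rw [Real.dist_eq]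
    refine h.trans (le_of_eq ?_)
    field_simp
  have hratio : Tendsto (fun n : ℕ => ((n : ℝ) + 1) / n) atTop (𝓝 1) := by
    have h := tendsto_one_div_atTop_nhds_zero_nat (𝕜 := ℝ)
    have h' := h.const_add 1
    rw [add_zero] at h'
    refine h'.congr' ?_
    filter_upwards [eventually_ne_atTop 0] with n hn
    have hn0 : (n : ℝ) ≠ 0 := by exact_mod_cast hn
    field_simp
  have h := (hratio.mul (hs1.mul hMH)).pow 2
  rw [show (1 * (1 * (2 * besselJ1 x))) ^ 2 = 4 * besselJ1 x ^ 2 by ring] at h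
  refine h.congr' ?_
  filter_upwards [hev] with n hn
  have hn0 : (n : ℝ) ≠ 0 := by exact_mod_cast hn.1
  have hres : residual (n + 1) ((x / n) ^ 2) = s n ^ (n + 2) * (gegenbauer n).eval (s n) := by
    rw [← residual_succ_eq]; congr 1; linarith [hs2 n hn.2]
  rw [hres]
  field_simp
  ring

/-- Lower bound: test at `u = (x / n)²` with `x` nearly maximising `J₁²`. Upper bound:
`mul_residual_sq_le`, whose second alternative tends to `0`. -/
theorem tendsto_noiseSup :
    Tendsto (fun k : ℕ => (k : ℝ) ^ 2 * noiseSup k) atTop (𝓝 (4 * besselJ1SqSup)) := by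
  rw [← tendsto_add_atTop_iff_nat 1]
  push_cast
  rw [tendsto_order]
  constructor
  · intro a ha
    have ha' : a / 4 < besselJ1SqSup := by linarith
    obtain ⟨_, ⟨x, hx, rfl⟩, hlt⟩ := exists_lt_of_lt_csSup (Set.Nonempty.image _ ⟨0, by simp⟩) ha'
    have h := tendsto_mul_residual_sq (x := x) hx
    have hxn : Tendsto (fun n : ℕ => x / (n : ℝ)) atTop (𝓝 0) :=
      tendsto_const_div_atTop_nhds_zero_nat x
    filter_upwards [h.eventually_const_lt (show a < 4 * besselJ1 x ^ 2 by linarith),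
      hxn.eventually_le_const one_pos] with n h1 h2
    refine h1.trans_le ?_
    have hx0 : 0 ≤ x := hx
    gcongr
    exact le_noiseSup _ ⟨by positivity, pow_le_one₀ (by positivity) h2⟩
  · intro a ha
    have hlim : Tendsto (fun n : ℕ =>
        max ((2 * Real.sqrt besselJ1SqSup + (3 / eighthRoot n ^ 5 + 1 / eighthRoot n ^ 7)) ^ 2)
        ((n + 1) * equatorEnergy n / (eighthRoot n * (1 - 3 / (4 * eighthRoot n ^ 2)))))
        atTop (𝓝 (4 * besselJ1SqSup)) := by
      have h1 : Tendsto (fun n : ℕ =>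
          (2 * Real.sqrt besselJ1SqSup + (3 / eighthRoot n ^ 5 + 1 / eighthRoot n ^ 7)) ^ 2)
          atTop (𝓝 (4 * besselJ1SqSup)) := by
        have h := (((tendsto_div_eighthRoot_pow 3 (m := 5) (by norm_num)).add
          (tendsto_div_eighthRoot_pow 1 (m := 7) (by norm_num))).const_add
          (2 * Real.sqrt besselJ1SqSup)).pow 2
        rw [add_zero, add_zero, mul_pow, Real.sq_sqrt besselJ1SqSup_pos.le] at h
        norm_num at h ⊢
        exact h
      have h2 : Tendsto (fun n : ℕ =>
          (n + 1) * equatorEnergy n / (eighthRoot n * (1 - 3 / (4 * eighthRoot n ^ 2))))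
          atTop (𝓝 0) := by
        have h3 := (tendsto_div_eighthRoot_pow (3 / 4) (m := 2) (by norm_num)).const_sub 1
        rw [sub_zero] at h3
        have h4 := tendsto_mul_equatorEnergy.div_atTop
          (tendsto_eighthRoot.atTop_mul_pos one_pos h3)
        refine h4.congr fun n => ?_
        rw [div_div]
      have := h1.max h2
      rwa [max_eq_left (by linarith [besselJ1SqSup_pos])] at this
    filter_upwards [hlim.eventually_lt_const ha, tendsto_eighthRoot.eventually_gt_atTop 1]
      with n h1 h2
    refine lt_of_le_of_lt ?_ h1
    rw [← eighthRoot_pow n, ← pow_mul, mul_comm, ← le_div_iff₀ (by positivity)]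
    refine csSup_le (Set.Nonempty.image _ ⟨0, by simp⟩) ?_
    rintro _ ⟨u, hu, rfl⟩
    rw [le_div_iff₀ (by positivity), mul_comm]
    have := mul_residual_sq_le n h2 (eighthRoot_pow n) hu
    rwa [eighthRoot_pow n]

/-- For `u = sin² φ` the quantity is `sin φ (cos² φ)^(n+2) v(φ)²`, with `v` the Liouville form. At a
critical point of `v` in `[a, b]` the last factor is bounded below by the dual energy; the first is
controlled by `a` and the second by `b`. -/
theorem exists_le_sq_mul_residual_sq (n : ℕ) {a b : ℝ} (ha : 0 < a) (ha1 : a ≤ 1) (hb1 : b ≤ 1)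
    (hab : a + 5 * Real.pi / (n + 1) ≤ b) (hna : 2 ≤ (n + 1) * a) :
    ∃ u ∈ Set.Icc (0 : ℝ) 1, (a - a ^ 3 / 6) * (1 - b ^ 2) ^ (n + 2) *
      (equatorEnergy n / ((n + 3 / 2) ^ 2 - 3 / 4)) ≤ u ^ 2 * residual (n + 1) u ^ 2 := by
  have hpi := Real.pi_gt_three
  have hle : 5 * Real.pi / (n + 3 / 2 : ℝ) ≤ 5 * Real.pi / (n + 1) := by gcongr; norm_num
  have hsa : a - a ^ 3 / 6 < Real.sin a := Real.sin_gt_sub_cube ha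
  have ha3 : a ^ 3 ≤ a := by
    calc a ^ 3 ≤ a ^ 1 := pow_le_pow_of_le_one ha.le ha1 (by norm_num)
      _ = a := pow_one a
  have hsa2 : 1 ≤ (n + 3 / 2) * Real.sin a := by
    have h1 : a / 2 ≤ Real.sin a := by linarith
    calc (1 : ℝ) ≤ (n + 1) * (a / 2) := by linarith
      _ ≤ (n + 3 / 2) * Real.sin a := by gcongr; norm_num
  obtain ⟨φ, hφ, hφ0, hφq⟩ := exists_liouvilleDeriv_eq_zero n ha (by linarith) hsa2
  have hφpos : 0 < φ := ha.trans_le hφ.1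
  have hφb : φ ≤ b := by linarith [hφ.2]
  have hφ2 : φ ≤ Real.pi / 2 := by linarith
  have hsin : 0 < Real.sin φ := sin_pos_of_mem ha ⟨hφ.1, hφ2⟩
  have hsc := Real.sin_sq_add_cos_sq φ
  have hc0 : (0 : ℝ) < (n + 3 / 2) ^ 2 - 3 / 4 := by
    have : (0 : ℝ) ≤ n := n.cast_nonneg
    nlinarith
  have hE : equatorEnergy n / ((n + 3 / 2) ^ 2 - 3 / 4) ≤ liouville n φ ^ 2 := by
    rw [div_le_iff₀ hc0, mul_comm]
    exact le_mul_sq_of_liouvilleDeriv_eq_zero n hφpos hφ2 hφq hφ0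
  refine ⟨Real.sin φ ^ 2, ⟨sq_nonneg _, Real.sin_sq_le_one φ⟩, ?_⟩
  have hres : residual (n + 1) (Real.sin φ ^ 2) =
      Real.cos φ ^ (n + 2) * (gegenbauer n).eval (Real.cos φ) := by
    rw [← residual_succ_eq]; congr 1; linarith
  have hcos : 1 - b ^ 2 ≤ Real.cos φ ^ 2 := by
    have h1 : Real.sin φ ≤ b := (Real.sin_le hφpos.le).trans hφb
    nlinarith
  have hb2 : 0 ≤ 1 - b ^ 2 := by nlinarith
  have hsin2 : a - a ^ 3 / 6 ≤ Real.sin φ := hsa.le.trans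
    (Real.sin_le_sin_of_le_of_le_pi_div_two (by linarith) hφ2 hφ.1)
  calc _ ≤ Real.sin φ * (Real.cos φ ^ 2) ^ (n + 2) * liouville n φ ^ 2 := by
        gcongr
        refine div_nonneg ?_ hc0.le
        rw [equatorEnergy]
        positivity
    _ = _ := by
        rw [hres, liouville, mul_pow (Real.sqrt _), Real.sq_sqrt hsin.le]
        ring

theorem tendsto_signalSup :
    Tendsto (fun k : ℕ => (k : ℝ) ^ (7 / 2 : ℝ) * signalSup k) atTop
      (𝓝 (8 * Real.exp (-(1 / 2)) / (Real.sqrt 2 * Real.pi))) := by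
  rw [← tendsto_add_atTop_iff_nat 1]
  have hpow : ∀ n : ℕ, ((n + 1 : ℕ) : ℝ) ^ (7 / 2 : ℝ) = eighthRoot n ^ 28 := by
    intro n
    rw [eighthRoot, ← Real.rpow_natCast, ← Real.rpow_mul (by positivity)]
    push_cast
    norm_num
  simp only [hpow]
  have htpos : ∀ n, 0 < eighthRoot n := fun n => by unfold eighthRoot; positivity
  have h2sq : Real.sqrt 2 ^ 2 = 2 := Real.sq_sqrt (by norm_num)
  -- `a = 1/√(2(n+1))` is asymptotically the peak of `y (1 - y²)^(n+2)`. The Sturm window has length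
  -- of order `1/n`, much shorter than `a`, so `n b² → 1/2` too and the critical point sees the full
  -- peak.
  set a : ℕ → ℝ := fun n => 1 / (Real.sqrt 2 * eighthRoot n ^ 4) with ha
  set b : ℕ → ℝ := fun n => a n + 5 * Real.pi / eighthRoot n ^ 8 with hb
  have ha0 : Tendsto a atTop (𝓝 0) :=
    (tendsto_div_eighthRoot_pow (1 / Real.sqrt 2) (m := 4) (by norm_num)).congr fun n => by
      simp only [ha]; rw [div_div]
  have hb0 : Tendsto b atTop (𝓝 0) := by
    simpa using ha0.add (tendsto_div_eighthRoot_pow (5 * Real.pi) (m := 8) (by norm_num))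
  have hlow : Tendsto (fun n => eighthRoot n ^ 28 * ((a n - a n ^ 3 / 6) *
      (1 - b n ^ 2) ^ (n + 2) * (equatorEnergy n / ((n + 3 / 2) ^ 2 - 3 / 4)))) atTop
      (𝓝 (8 * Real.exp (-(1 / 2)) / (Real.sqrt 2 * Real.pi))) := by
    have h1 : Tendsto (fun n => eighthRoot n ^ 4 * (a n - a n ^ 3 / 6)) atTop
        (𝓝 (1 / Real.sqrt 2)) := by
      have h := (tendsto_div_eighthRoot_pow (1 / (Real.sqrt 2 ^ 3 * 6)) (m := 8)
        (by norm_num)).const_sub (1 / Real.sqrt 2)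
      rw [sub_zero] at h
      refine h.congr fun n => ?_
      have := htpos n
      simp only [ha]
      field_simp
    have h2 : Tendsto (fun n => (1 - b n ^ 2) ^ (n + 2)) atTop (𝓝 (Real.exp (-(1 / 2)))) := by
      have hg : Tendsto (fun n : ℕ => (n : ℝ) * -(b n ^ 2)) atTop (𝓝 (-(1 / 2))) := by
        have h := ((((tendsto_div_eighthRoot_pow (5 * Real.pi) (m := 4)
          (by norm_num)).const_add (1 / Real.sqrt 2)).pow 2).mul
          ((tendsto_div_eighthRoot_pow 1 (m := 8) (by norm_num)).const_sub 1)).neg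
        rw [add_zero, sub_zero, div_pow, h2sq, one_pow, mul_one] at h
        refine h.congr fun n => ?_
        have := htpos n
        have hn : (n : ℝ) = eighthRoot n ^ 8 - 1 := by rw [eighthRoot_pow]; ring
        rw [hn]
        simp only [hb, ha]
        field_simp
      have h := (Real.tendsto_one_add_pow_exp_of_tendsto hg).mul (((hb0.pow 2).const_sub 1).pow 2)
      rw [show Real.exp (-(1 / 2)) * (1 - 0 ^ 2) ^ 2 = Real.exp (-(1 / 2)) by ring] at h
      refine h.congr fun n => ?_
      rw [← sub_eq_add_neg, ← pow_add]
    have h3 : Tendsto (fun n : ℕ => ((n + 3 / 2 : ℝ) ^ 2 - 3 / 4) / eighthRoot n ^ 16) atTop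
        (𝓝 1) := by
      have h := ((tendsto_div_eighthRoot_pow 1 (m := 8) (by norm_num)).const_add 1).sub
        (tendsto_div_eighthRoot_pow (1 / 2) (m := 16) (by norm_num))
      rw [add_zero, sub_zero] at h
      refine h.congr fun n => ?_
      have := htpos n
      have hn : (n : ℝ) = eighthRoot n ^ 8 - 1 := by rw [eighthRoot_pow]; ring
      rw [hn]
      field_simp
      ring
    have h := ((h1.mul h2).mul tendsto_mul_equatorEnergy).div h3 one_ne_zero
    rw [show 1 / Real.sqrt 2 * Real.exp (-(1 / 2)) * (8 / Real.pi) / 1 =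
      8 * Real.exp (-(1 / 2)) / (Real.sqrt 2 * Real.pi) by field_simp] at h
    refine h.congr fun n => ?_
    have := htpos n
    simp only [Pi.div_apply]
    rw [← eighthRoot_pow n]
    generalize (n + 3 / 2 : ℝ) ^ 2 - 3 / 4 = D
    rw [div_div_eq_mul_div]
    ring
  have hup : Tendsto (fun n : ℕ => max (1 / eighthRoot n ^ 2)
      (Real.exp (-(1 / 2)) / Real.sqrt 2 * ((n + 1) * equatorEnergy n) /
        (1 - 3 / (4 * eighthRoot n)))) atTop
      (𝓝 (8 * Real.exp (-(1 / 2)) / (Real.sqrt 2 * Real.pi))) := by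
    have h1 := (tendsto_div_eighthRoot_pow (3 / 4) (m := 1) (by norm_num)).const_sub 1
    rw [sub_zero] at h1
    have h2 := (tendsto_mul_equatorEnergy.const_mul (Real.exp (-(1 / 2)) / Real.sqrt 2)).div h1
      one_ne_zero
    have h3 := (tendsto_div_eighthRoot_pow 1 (m := 2) (by norm_num)).max h2
    rw [show Real.exp (-(1 / 2)) / Real.sqrt 2 * (8 / Real.pi) / 1 =
      8 * Real.exp (-(1 / 2)) / (Real.sqrt 2 * Real.pi) by field_simp,
      max_eq_right (by positivity)] at h3
    refine h3.congr fun n => ?_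
    simp only [Pi.div_apply, pow_one]
    rw [div_div]
  refine tendsto_of_tendsto_of_tendsto_of_le_of_le' hlow hup ?_ ?_
  · filter_upwards [ha0.eventually_le_const one_pos, hb0.eventually_le_const one_pos,
      tendsto_eighthRoot.eventually_ge_atTop 2] with n h1 h2 h3
    have := htpos n
    have h4 : 2 ≤ (n + 1) * a n := by
      rw [← eighthRoot_pow n]
      simp only [ha]
      rw [mul_one_div, le_div_iff₀ (by positivity)]
      have h5 : Real.sqrt 2 ≤ 2 := by nlinarith [Real.sqrt_nonneg 2]
      have h6 : (4 : ℝ) ≤ eighthRoot n ^ 4 := by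
        calc (4 : ℝ) ≤ 2 ^ 4 := by norm_num
          _ ≤ _ := by gcongr
      calc 2 * (Real.sqrt 2 * eighthRoot n ^ 4) ≤ 2 * (2 * eighthRoot n ^ 4) := by gcongr
        _ = 4 * eighthRoot n ^ 4 := by ring
        _ ≤ eighthRoot n ^ 4 * eighthRoot n ^ 4 := by gcongr
        _ = eighthRoot n ^ 8 := by ring
    obtain ⟨u, hu, hle⟩ := exists_le_sq_mul_residual_sq n (a := a n) (b := b n)
      (by simp only [ha]; positivity) h1 h2 (by simp only [hb]; rw [eighthRoot_pow]) h4
    gcongr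
    exact hle.trans (le_signalSup _ hu)
  · filter_upwards [tendsto_eighthRoot.eventually_gt_atTop 1] with n h2
    rw [mul_comm, ← le_div_iff₀ (by positivity)]
    refine csSup_le (Set.Nonempty.image _ ⟨0, by simp⟩) ?_
    rintro _ ⟨u, hu, rfl⟩
    rw [le_div_iff₀ (by positivity), mul_comm]
    exact sq_mul_residual_sq_le n h2 (eighthRoot_pow n) hu

/-! ### Gradients along Nesterov's method -/

variable {n d : ℕ}

theorem gradient_lsObjective (A : Matrix (Fin n) (Fin d) ℝ) (b : EuclideanSpace ℝ (Fin n))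
    (x : EuclideanSpace ℝ (Fin d)) :
    gradient (lsObjective A b) x =
      WithLp.toLp 2 ((1 / (n : ℝ)) • A.transpose.mulVec ((applyMatrix A x - b).ofLp)) := by
  apply HasGradientAt.gradient
  rw [hasGradientAt_iff_hasFDerivAt]
  set L : EuclideanSpace ℝ (Fin d) →L[ℝ] EuclideanSpace ℝ (Fin n) :=
    (Matrix.toEuclideanLin A).toContinuousLinearMap with hL
  have hLx : ∀ z, L z = applyMatrix A z := fun z => rfl
  have h := ((L.hasFDerivAt (x := x)).sub_const b).norm_sq.const_mul (1 / (2 * (n : ℝ)))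
  refine h.congr_fderiv ?_
  ext z
  simp only [smul_apply, ContinuousLinearMap.comp_apply, hLx,
    innerSL_apply_apply, InnerProductSpace.toDual_apply_apply, smul_eq_mul, nsmul_eq_mul]
  simp only [EuclideanSpace.inner_eq_star_dotProduct, star_trivial, applyMatrix]
  rw [dotProduct_comm, Matrix.dotProduct_mulVec, dotProduct_comm _ z.ofLp, dotProduct_smul, smul_eq_mul,
    ← Matrix.mulVec_transpose, dotProduct_comm z.ofLp]
  push_cast
  -- For `n = 0` both prefactors are `0` by the convention on division.
  rcases eq_or_ne (n : ℝ) 0 with h0 | h0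
  · simp [h0]
  · field_simp

theorem gradient_lsObjective_ofLp (A : Matrix (Fin n) (Fin d) ℝ) (b : EuclideanSpace ℝ (Fin n))
    (x : EuclideanSpace ℝ (Fin d)) :
    (gradient (lsObjective A b) x).ofLp = (hessianMatrix A).mulVec x.ofLp -
      (1 / (n : ℝ)) • A.transpose.mulVec b.ofLp := by
  rw [gradient_lsObjective]
  simp [applyMatrix, hessianMatrix, Matrix.mulVec_sub, Matrix.smul_mulVec, smul_sub]

/-- The gradient is affine with linear part `H`, so a gradient step multiplies it by `1 - α H`, and
a momentum step, whose coefficients sum to one, acts on gradients exactly as on points. -/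
theorem gradient_nesterovPair (A : Matrix (Fin n) (Fin d) ℝ) (b : EuclideanSpace ℝ (Fin n))
    (α : ℝ) (x₀ : EuclideanSpace ℝ (Fin d)) (k : ℕ) :
    (gradient (lsObjective A b) (nesterovPair (lsObjective A b) α x₀ k).1).ofLp =
        (Polynomial.aeval (α • hessianMatrix A) (nesterovPoly k).1).mulVec
          (gradient (lsObjective A b) x₀).ofLp ∧
      (gradient (lsObjective A b) (nesterovPair (lsObjective A b) α x₀ k).2).ofLp =
        (Polynomial.aeval (α • hessianMatrix A) (nesterovPoly k).2).mulVec
          (gradient (lsObjective A b) x₀).ofLp := by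
  set G := gradient (lsObjective A b) with hG
  set H := hessianMatrix A with hH
  have hstep : ∀ y, (G (y - α • G y)).ofLp = (1 - α • H).mulVec (G y).ofLp := by
    intro y
    rw [Matrix.sub_mulVec, Matrix.one_mulVec, Matrix.smul_mulVec]
    conv_lhs => rw [hG, gradient_lsObjective_ofLp]
    rw [WithLp.ofLp_sub, WithLp.ofLp_smul, Matrix.mulVec_sub, Matrix.mulVec_smul]
    conv_rhs => enter [1]; rw [hG, gradient_lsObjective_ofLp]
    abel
  have hmom : ∀ x x' : EuclideanSpace ℝ (Fin d), ∀ c : ℝ,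
      (G (x' + c • (x' - x))).ofLp = (G x').ofLp + c • ((G x').ofLp - (G x).ofLp) := by
    intro x x' c
    simp only [hG, gradient_lsObjective_ofLp, WithLp.ofLp_add, WithLp.ofLp_smul, WithLp.ofLp_sub,
      Matrix.mulVec_add, Matrix.mulVec_smul, Matrix.mulVec_sub]
    rw [sub_sub_sub_cancel_right]
    abel
  induction k with
  | zero => simp [nesterovPair, nesterovPoly]
  | succ k ih =>
    obtain ⟨ih1, ih2⟩ := ih
    have h1 : (G (nesterovPair (lsObjective A b) α x₀ (k + 1)).1).ofLp =
        (Polynomial.aeval (α • H) (nesterovPoly (k + 1)).1).mulVec (G x₀).ofLp := by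
      simp only [nesterovPair, nesterovPoly]
      rw [hstep, ih2, Matrix.mulVec_mulVec]
      simp
    refine ⟨h1, ?_⟩
    have h2 : (nesterovPair (lsObjective A b) α x₀ (k + 1)).2 =
        (nesterovPair (lsObjective A b) α x₀ (k + 1)).1 + ((k : ℝ) / (k + 3)) •
          ((nesterovPair (lsObjective A b) α x₀ (k + 1)).1 -
            (nesterovPair (lsObjective A b) α x₀ k).1) := rfl
    have h3 : (nesterovPoly (k + 1)).2 = (nesterovPoly (k + 1)).1 +
        Polynomial.C ((k : ℝ) / (k + 3)) * ((nesterovPoly (k + 1)).1 - (nesterovPoly k).1) := rfl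
    rw [h2, hmom, h1, ih1, h3, map_add, map_mul, map_sub, Polynomial.aeval_C, Matrix.add_mulVec,
      ← Algebra.smul_def, Matrix.smul_mulVec, Matrix.sub_mulVec]

/-! ### The expected squared gradient as a spectral sum -/

theorem transpose_aeval (H : Matrix (Fin d) (Fin d) ℝ) (hH : H.transpose = H) (p : Polynomial ℝ) :
    (Polynomial.aeval H p).transpose = Polynomial.aeval H p := by
  induction p using Polynomial.induction_on' with
  | add p q hp hq => simp [hp, hq]
  | monomial m a => simp [Polynomial.aeval_monomial, ← Algebra.smul_def, Matrix.transpose_pow, hH]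

theorem transpose_hessianMatrix (A : Matrix (Fin n) (Fin d) ℝ) :
    (hessianMatrix A).transpose = hessianMatrix A := by
  simp [hessianMatrix]

theorem aeval_diagonal (v : Fin d → ℝ) (p : Polynomial ℝ) :
    Polynomial.aeval (Matrix.diagonal v) p = Matrix.diagonal fun i => p.eval (v i) := by
  have h := Polynomial.aeval_algHom_apply (Matrix.diagonalAlgHom (n := Fin d) (α := ℝ) ℝ) v p
  simp only [Matrix.diagonalAlgHom_apply] at h
  rw [h]
  congr 1
  ext i
  simp [Polynomial.aeval_fn_apply]

theorem trace_aeval_eigenvalues {H : Matrix (Fin d) (Fin d) ℝ} (hH : H.IsHermitian)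
    (p : Polynomial ℝ) :
    (Polynomial.aeval H p).trace = ∑ i, p.eval (hH.eigenvalues i) := by
  have h := hH.spectral_theorem
  set D : Matrix (Fin d) (Fin d) ℝ := Matrix.diagonal (RCLike.ofReal ∘ hH.eigenvalues) with hD
  set f := Unitary.conjStarAlgAut ℝ (Matrix (Fin d) (Fin d) ℝ) hH.eigenvectorUnitary with hf
  have h2 : Polynomial.aeval H p = f (Polynomial.aeval D p) := by
    conv_lhs => rw [h]
    exact Polynomial.aeval_algHom_apply f D p
  rw [h2, hf, Unitary.conjStarAlgAut_apply, Matrix.trace_mul_cycle, Unitary.coe_star_mul_self,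
    one_mul, hD, aeval_diagonal, Matrix.trace_diagonal]
  rfl

/-- The contribution of an eigenvalue `l` of `H` to `E ‖∇f(x_k)‖²`, with signal weight `a`,
noise weight `b` and step size `α`. -/
noncomputable def spectralLoss (α : ℝ) (k : ℕ) (a b l : ℝ) : ℝ :=
  (a * l ^ 2 + b * l) * residual k (α * l) ^ 2

theorem second_moment_linear {Ω ι : Type*} [Fintype ι] [DecidableEq ι] [MeasurableSpace Ω]
    {P : Measure Ω} {X : ι → Ω → ℝ} {v : ι → ℝ} (hX : ∀ i, MemLp (X i) 2 P)
    (hcov : ∀ i j, ∫ ω, X i ω * X j ω ∂P = if i = j then v i else 0) (c : ι → ℝ) :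
    Integrable (fun ω => (∑ i, c i * X i ω) ^ 2) P ∧
      ∫ ω, (∑ i, c i * X i ω) ^ 2 ∂P = ∑ i, c i ^ 2 * v i := by
  have hexp : (fun ω => (∑ i, c i * X i ω) ^ 2) =
      fun ω => ∑ i, ∑ j, c i * c j * (X i ω * X j ω) := by
    ext ω
    rw [sq, Finset.sum_mul_sum]
    exact Finset.sum_congr rfl fun i _ => Finset.sum_congr rfl fun j _ => by ring
  have hint : ∀ i j, Integrable (fun ω => c i * c j * (X i ω * X j ω)) P := fun i j =>
    ((hX i).integrable_mul (hX j)).const_mul _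
  rw [hexp]
  refine ⟨integrable_finsetSum _ fun i _ => integrable_finsetSum _ fun j _ => hint i j, ?_⟩
  rw [integral_finsetSum _ fun i _ => integrable_finsetSum _ fun j _ => hint i j]
  refine Finset.sum_congr rfl fun i _ => ?_
  rw [integral_finsetSum _ fun j _ => hint i j]
  simp only [integral_const_mul, hcov, mul_ite, mul_zero, Finset.sum_ite_eq, Finset.mem_univ,
    if_true]
  ring

theorem memLp_two_of_integrable_pow_four {Ω : Type*} [MeasurableSpace Ω] {P : Measure Ω}
    [IsFiniteMeasure P] {X : Ω → ℝ} (hm : Measurable X) (h : Integrable (fun ω => X ω ^ 4) P) :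
    MemLp X 2 P := by
  rw [memLp_two_iff_integrable_sq hm.aestronglyMeasurable]
  refine (h.add (integrable_const 1)).mono' (hm.pow_const 2).aestronglyMeasurable
    (Eventually.of_forall fun ω => ?_)
  rw [Real.norm_of_nonneg (sq_nonneg _)]
  simp only [Pi.add_apply]
  nlinarith [sq_nonneg (X ω ^ 2 - 1), sq_nonneg (X ω ^ 2)]

section Moments

variable {Ω : Type*} [MeasurableSpace Ω] {P : Measure Ω}
  {x₀ xs : Ω → EuclideanSpace ℝ (Fin d)} {η : Ω → EuclideanSpace ℝ (Fin n)} {R Rt C Ct : ℝ}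

theorem VectorAssumption.measurable_diff (h : VectorAssumption P x₀ xs η R Rt C Ct) (i : Fin d) :
    Measurable fun ω => (x₀ ω - xs ω) i := by
  have := h.measurable_init.sub h.measurable_signal
  exact (EuclideanSpace.proj (𝕜 := ℝ) i).measurable.comp this

theorem VectorAssumption.measurable_noise_apply (h : VectorAssumption P x₀ xs η R Rt C Ct)
    (i : Fin n) : Measurable fun ω => η ω i :=
  (EuclideanSpace.proj (𝕜 := ℝ) i).measurable.comp h.measurable_noise

theorem VectorAssumption.diff_second_moment [IsProbabilityMeasure P]
    (h : VectorAssumption P x₀ xs η R Rt C Ct)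
    (i : Fin d) : ∫ ω, (x₀ ω - xs ω) i ^ 2 ∂P = R ^ 2 / d := by
  have hmem : ∀ j, MemLp (fun ω => (x₀ ω - xs ω) j) 2 P := fun j =>
    memLp_two_of_integrable_pow_four (h.measurable_diff j) (h.diff_fourth_integrable j)
  have hsum := h.diff_sq
  simp only [EuclideanSpace.real_norm_sq_eq] at hsum
  rw [integral_finsetSum _ fun j _ => (hmem j).integrable_sq] at hsum
  have heq : ∀ j, ∫ ω, (x₀ ω - xs ω) j ^ 2 ∂P = ∫ ω, (x₀ ω - xs ω) i ^ 2 ∂P := fun j =>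
    (h.diff_identDistrib j i).sq.integral_eq
  simp only [heq, Finset.sum_const, Finset.card_univ, Fintype.card_fin, nsmul_eq_mul] at hsum
  have hd : (d : ℝ) ≠ 0 := by
    have := i.pos
    positivity
  rw [eq_div_iff hd, mul_comm, hsum]

/-- Stacked together, the entries of `x₀ - x̃` and `η` form one centred, pairwise uncorrelated
family, so only the squared Frobenius norms of `U` and `V` survive. -/
theorem VectorAssumption.second_moment [IsProbabilityMeasure P]
    (h : VectorAssumption P x₀ xs η R Rt C Ct)
    (U : Matrix (Fin d) (Fin d) ℝ) (V : Matrix (Fin d) (Fin n) ℝ) :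
    Integrable (fun ω => ∑ i, (U.mulVec (x₀ ω - xs ω).ofLp i - V.mulVec (η ω).ofLp i) ^ 2) P ∧
      ∫ ω, ∑ i, (U.mulVec (x₀ ω - xs ω).ofLp i - V.mulVec (η ω).ofLp i) ^ 2 ∂P =
        R ^ 2 / d * (U * U.transpose).trace + Rt ^ 2 * (V * V.transpose).trace := by
  set X : Fin d ⊕ Fin n → Ω → ℝ :=
    Sum.elim (fun i ω => (x₀ ω - xs ω) i) (fun i ω => η ω i) with hX
  have hmem : ∀ j, MemLp (X j) 2 P := by
    rintro (j | j)
    · exact memLp_two_of_integrable_pow_four (h.measurable_diff j) (h.diff_fourth_integrable j)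
    · exact memLp_two_of_integrable_pow_four (h.measurable_noise_apply j)
        (h.noise_fourth_integrable j)
  have hmean : ∀ j, ∫ ω, X j ω ∂P = 0 := by
    rintro (j | j)
    · exact h.diff_mean j
    · exact h.noise_mean j
  have hindep : ∀ i j, i ≠ j → IndepFun (X i) (X j) P := by
    have hcross : ∀ i j, IndepFun (fun ω => (x₀ ω - xs ω) i) (fun ω => η ω j) P := fun i j =>
      h.indep.comp (EuclideanSpace.proj (𝕜 := ℝ) i).measurable
        (EuclideanSpace.proj (𝕜 := ℝ) j).measurable
    rintro (i | i) (j | j) hij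
    · exact h.diff_iIndep.indepFun fun h => hij (by rw [h])
    · exact hcross i j
    · exact (hcross j i).symm
    · exact h.noise_iIndep.indepFun fun h => hij (by rw [h])
  have hcov : ∀ i j, ∫ ω, X i ω * X j ω ∂P =
      if i = j then Sum.elim (fun _ => R ^ 2 / d) (fun _ => Rt ^ 2) i else 0 := by
    intro i j
    split_ifs with hij
    · subst hij
      simp only [← sq]
      rcases i with i | i
      · exact h.diff_second_moment i
      · exact h.noise_sq i
    · rw [(hindep i j hij).integral_fun_mul_eq_mul_integral (hmem i).aestronglyMeasurable
        (hmem j).aestronglyMeasurable, hmean, zero_mul]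
  have hrow := fun i => second_moment_linear hmem hcov (Sum.elim (U i) (fun j => -V i j))
  have heq : ∀ i ω, U.mulVec (x₀ ω - xs ω).ofLp i - V.mulVec (η ω).ofLp i =
      ∑ j, Sum.elim (U i) (fun j => -V i j) j * X j ω := by
    intro i ω
    simp [hX, Fintype.sum_sum_type, Matrix.mulVec, dotProduct, sub_eq_add_neg]
  simp only [heq]
  refine ⟨integrable_finsetSum _ fun i _ => (hrow i).1, ?_⟩
  rw [integral_finsetSum _ fun i _ => (hrow i).1]
  rw [Finset.sum_congr rfl fun i _ => (hrow i).2]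
  simp only [Fintype.sum_sum_type, Sum.elim_inl, Sum.elim_inr, Finset.sum_add_distrib,
    Matrix.trace, Matrix.diag, Matrix.mul_apply, Matrix.transpose_apply, Finset.mul_sum]
  congr 1 <;> exact Finset.sum_congr rfl fun i _ => Finset.sum_congr rfl fun j _ => by ring

/-- With `B = p_k(αH)` the gradient is `B H (x₀ - x̃) - B Aᵀ η / n`, and `AᵀA / n = H` makes both
Gram matrices polynomials in `H`. The list `l` is any list with the right traces, so that the
entries of a diagonal matrix serve as well as the ordered eigenvalues. -/
theorem VectorAssumption.nesterovGradSq_moment [IsProbabilityMeasure P]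
    (h : VectorAssumption P x₀ xs η R Rt C Ct)
    (A : Matrix (Fin n) (Fin d) ℝ) (k : ℕ) :
    Integrable (fun ω => nesterovGradSq A (x₀ ω) (xs ω) (η ω) k) P ∧
      ∀ l : Fin d → ℝ,
        (∀ p : Polynomial ℝ, (Polynomial.aeval (hessianMatrix A) p).trace = ∑ i, p.eval (l i)) →
        ∫ ω, nesterovGradSq A (x₀ ω) (xs ω) (η ω) k ∂P =
          ∑ i, spectralLoss (1 / topEigenvalue A) k (R ^ 2 / d) (Rt ^ 2 / n) (l i) := by
  set α := 1 / topEigenvalue A with hα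
  set H := hessianMatrix A with hH
  set p : Polynomial ℝ := (nesterovPoly k).1.comp (Polynomial.C α * Polynomial.X) with hp
  set B := Polynomial.aeval H p with hB
  have hBα : Polynomial.aeval (α • H) (nesterovPoly k).1 = B := by
    rw [hB, hp, Polynomial.aeval_comp, map_mul, Polynomial.aeval_C, Polynomial.aeval_X,
      Algebra.smul_def]
  have hBt : B.transpose = B := transpose_aeval H (transpose_hessianMatrix A) p
  have hHt : H.transpose = H := transpose_hessianMatrix A
  have hval : ∀ ω, nesterovGradSq A (x₀ ω) (xs ω) (η ω) k =
      ∑ i, ((B * H).mulVec (x₀ ω - xs ω).ofLp i -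
        ((1 / (n : ℝ)) • (B * A.transpose)).mulVec (η ω).ofLp i) ^ 2 := by
    intro ω
    rw [nesterovGradSq]
    simp only
    rw [EuclideanSpace.real_norm_sq_eq]
    refine Finset.sum_congr rfl fun i _ => ?_
    rw [(gradient_nesterovPair A _ _ _ k).1, hBα, gradient_lsObjective_ofLp]
    congr 1
    have hfactor : ∀ (v : Fin d → ℝ) (w : Fin n → ℝ), (B * H).mulVec v -
        ((1 / (n : ℝ)) • (B * A.transpose)).mulVec w =
          B.mulVec (H.mulVec v - (1 / (n : ℝ)) • A.transpose.mulVec w) := by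
      intro v w
      simp only [Matrix.mulVec_sub, Matrix.mulVec_smul, Matrix.smul_mulVec, Matrix.mulVec_mulVec]
    rw [← Pi.sub_apply, hfactor, WithLp.ofLp_sub, WithLp.ofLp_add]
    refine congrFun (congrArg B.mulVec ?_) i
    simp only [applyMatrix, Matrix.mulVec_add, Matrix.mulVec_sub, smul_add, hH, hessianMatrix,
      Matrix.smul_mulVec, Matrix.mulVec_mulVec]
    abel
  simp only [hval]
  obtain ⟨hint, hmom⟩ := h.second_moment (B * H) ((1 / (n : ℝ)) • (B * A.transpose))
  refine ⟨hint, fun l hl => ?_⟩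
  rw [hmom]
  have h1 : B * H * (B * H).transpose =
      Polynomial.aeval H (p * Polynomial.X * (Polynomial.X * p)) := by
    simp only [map_mul, Polynomial.aeval_X, Matrix.transpose_mul, hBt, hHt, ← hB]
  have h2 : (1 / (n : ℝ)) • (B * A.transpose) * ((1 / (n : ℝ)) • (B * A.transpose)).transpose =
      (1 / (n : ℝ)) • Polynomial.aeval H (p * Polynomial.X * p) := by
    have hHA : H = (1 / (n : ℝ)) • (A.transpose * A) := rfl
    rw [map_mul, map_mul, Polynomial.aeval_X, ← hB, hHA]
    simp only [Matrix.transpose_smul, Matrix.transpose_mul, hBt, Matrix.transpose_transpose,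
      Matrix.smul_mul, Matrix.mul_smul, Matrix.mul_assoc]
  rw [h1, h2, Matrix.trace_smul, hl, hl, smul_eq_mul, Finset.mul_sum, Finset.mul_sum,
    Finset.mul_sum, ← Finset.sum_add_distrib]
  refine Finset.sum_congr rfl fun i _ => ?_
  simp only [spectralLoss, residual, hp, Polynomial.eval_mul, Polynomial.eval_comp,
    Polynomial.eval_C, Polynomial.eval_X]
  ring

end Moments

/-! ### The adversary's optimisation over spectra -/

theorem isHermitian_hessianMatrix (A : Matrix (Fin n) (Fin d) ℝ) :
    (hessianMatrix A).IsHermitian := by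
  rw [Matrix.IsHermitian, Matrix.conjTranspose_eq_transpose_of_trivial, transpose_hessianMatrix]

/-- Extreme points of a convex hull belong to the original set, so both edges are genuine
eigenvalues. -/
theorem spectrum_of_feasible {A : Matrix (Fin n) (Fin d) ℝ} {lo hi : ℝ} (hle : lo ≤ hi)
    (hA : A ∈ feasibleMatrices n d lo hi) :
    lo ∈ spectrum ℝ (hessianMatrix A) ∧ hi ∈ spectrum ℝ (hessianMatrix A) ∧
      spectrum ℝ (hessianMatrix A) ⊆ Set.Icc lo hi := by
  have hA' : convexHull ℝ (spectrum ℝ (hessianMatrix A)) = Set.Icc lo hi := hA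
  have hext := extremePoints_convexHull_subset (𝕜 := ℝ) (A := spectrum ℝ (hessianMatrix A))
  rw [hA', Set.extremePoints_Icc hle] at hext
  exact ⟨hext (by simp), hext (by simp), hA' ▸ subset_convexHull ℝ _⟩

theorem topEigenvalue_of_feasible {A : Matrix (Fin n) (Fin d) ℝ} {lo hi : ℝ} (hle : lo ≤ hi)
    (hA : A ∈ feasibleMatrices n d lo hi) : topEigenvalue A = hi := by
  obtain ⟨-, h2, h3⟩ := spectrum_of_feasible hle hA
  exact IsGreatest.csSup_eq ⟨h2, fun x hx => (h3 hx).2⟩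

theorem card_eigenvalues_ne_zero_le (A : Matrix (Fin n) (Fin d) ℝ) :
    (Finset.univ.filter fun i => (isHermitian_hessianMatrix A).eigenvalues i ≠ 0).card ≤ n := by
  have h := (isHermitian_hessianMatrix A).rank_eq_card_non_zero_eigs
  rw [Fintype.card_subtype] at h
  rw [← h, hessianMatrix, ← Matrix.smul_mul]
  exact (Matrix.rank_mul_le_right _ _).trans A.rank_le_height

/-- Zero eigenvalues contribute nothing. At most `n` are nonzero by the rank, and at most `d - 1`
since the lower edge `0` occupies an index; one of the nonzero ones is `hi`, and each other costs at
most `B`. -/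
theorem sum_eigenvalues_le {A : Matrix (Fin n) (Fin d) ℝ} {hi B : ℝ} (hhi : 0 < hi)
    (hA : A ∈ feasibleMatrices n d 0 hi) {φ : ℝ → ℝ} (hφ0 : φ 0 = 0) (hB0 : 0 ≤ B)
    (hφ : ∀ l ∈ Set.Icc 0 hi, φ l ≤ B) :
    ∑ i, φ ((isHermitian_hessianMatrix A).eigenvalues i) ≤
      φ hi + ((min n (d - 1) : ℕ) - 1 : ℝ) * B := by
  obtain ⟨h1, h2, h3⟩ := spectrum_of_feasible hhi.le hA
  rw [(isHermitian_hessianMatrix A).spectrum_real_eq_range_eigenvalues] at h1 h2 h3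
  have hn := card_eigenvalues_ne_zero_le A
  set l := (isHermitian_hessianMatrix A).eigenvalues with hl
  obtain ⟨i₀, hi₀⟩ := h1
  obtain ⟨i₁, hi₁⟩ := h2
  set T := Finset.univ.filter fun i => l i ≠ 0 with hT
  have hmem : i₁ ∈ T := by simp [hT, hi₁, hhi.ne']
  have hcard : T.card ≤ min n (d - 1) := by
    refine le_min hn ?_
    have hsub : T ⊆ Finset.univ.erase i₀ := by
      intro i hiT
      simp only [hT, Finset.mem_filter, Finset.mem_univ, true_and] at hiT
      simp only [Finset.mem_erase, Finset.mem_univ, and_true]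
      rintro rfl
      exact hiT hi₀
    simpa using Finset.card_le_card hsub
  have hsum : ∑ i, φ (l i) = ∑ i ∈ T, φ (l i) := by
    refine (Finset.sum_subset (Finset.subset_univ T) fun i _ hiT => ?_).symm
    have : l i = 0 := by simpa [hT] using hiT
    rw [this, hφ0]
  rw [hsum, ← Finset.add_sum_erase T _ hmem, hi₁]
  gcongr
  have h4 : ∑ i ∈ T.erase i₁, φ (l i) ≤ (T.erase i₁).card • B :=
    Finset.sum_le_card_nsmul _ _ _ fun i _ => hφ _ (h3 ⟨i, rfl⟩)
  rw [nsmul_eq_mul, Finset.card_erase_of_mem hmem,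
    Nat.cast_sub (Finset.card_pos.2 ⟨i₁, hmem⟩), Nat.cast_one] at h4
  refine h4.trans ?_
  gcongr

/-- The rectangular matrix with diagonal entries `√(n μ_j)`. -/
noncomputable def rectDiagonal (n d : ℕ) (μ : ℕ → ℝ) : Matrix (Fin n) (Fin d) ℝ :=
  Matrix.of fun i j => if (i : ℕ) = j then Real.sqrt (n * μ j) else 0

theorem hessianMatrix_rectDiagonal (hn : n ≠ 0) {μ : ℕ → ℝ} (hμ : ∀ j, 0 ≤ μ j)
    (hμn : ∀ j, n ≤ j → μ j = 0) :
    hessianMatrix (rectDiagonal n d μ) = Matrix.diagonal fun j : Fin d => μ j := by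
  have hn' : (n : ℝ) ≠ 0 := by exact_mod_cast hn
  ext j j'
  simp only [hessianMatrix, rectDiagonal, Matrix.smul_apply, Matrix.mul_apply,
    Matrix.transpose_apply, Matrix.of_apply, Matrix.diagonal_apply, smul_eq_mul]
  by_cases hj : (j : ℕ) < n
  · rw [Finset.sum_eq_single ⟨j, hj⟩]
    · by_cases hjj : j = j'
      · subst hjj
        have := hμ j
        simp only [if_true]
        rw [Real.mul_self_sqrt (by positivity)]
        field_simp
      · have : (j : ℕ) ≠ j' := fun h => hjj (Fin.ext h)
        simp [hjj, this]
    · intro i _ hij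
      have : (i : ℕ) ≠ j := fun h => hij (Fin.ext h)
      simp [this]
    · simp
  · have hz : μ j = 0 := hμn j (by omega)
    rw [Finset.sum_eq_zero]
    · split_ifs <;> simp [hz]
    · intro i _
      have : (i : ℕ) ≠ j := by have := i.2; omega
      simp [this]

theorem sum_extremal (φ : ℝ → ℝ) (hφ0 : φ 0 = 0) {K : ℕ} (hK : 1 ≤ K) (hKd : K ≤ d) (hi l : ℝ) :
    ∑ j : Fin d, φ (if (j : ℕ) = 0 then hi else if (j : ℕ) < K then l else 0) =
      φ hi + (K - 1 : ℝ) * φ l := by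
  rw [Fin.sum_univ_eq_sum_range
    (fun j : ℕ => φ (if j = 0 then hi else if j < K then l else 0)) d]
  obtain ⟨K, rfl⟩ : ∃ K', K = K' + 1 := ⟨K - 1, by omega⟩
  obtain ⟨e, rfl⟩ := Nat.exists_eq_add_of_le hKd
  rw [Finset.sum_range_add, Finset.sum_range_succ']
  have h1 : ∑ j ∈ Finset.range K,
      φ (if j + 1 = 0 then hi else if j + 1 < K + 1 then l else 0) = K * φ l := by
    rw [Finset.sum_congr rfl (g := fun _ => φ l)]
    · simp
    · intro j hj
      have : j < K := Finset.mem_range.1 hj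
      simp [this]
  have h2 : ∑ j ∈ Finset.range e, φ (if K + 1 + j = 0 then hi else
      if K + 1 + j < K + 1 then l else 0) = 0 := by
    refine Finset.sum_eq_zero fun j _ => ?_
    rw [if_neg (by omega), if_neg (by omega), hφ0]
  rw [h1, h2]
  push_cast
  simp
  ring

/-- The extremal matrix for `sum_eigenvalues_le`. The cutoff `min n (d - 1)` leaves the last
diagonal entry `0`, so that the lower edge is attained, and makes all entries from index `n` on
vanish, as an `n × d` matrix requires. -/
theorem exists_feasible_diagonal (hn : 1 ≤ n) (hd : 2 ≤ d) {hi l : ℝ} (hhi : 0 < hi)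
    (hl : l ∈ Set.Icc 0 hi) :
    ∃ A ∈ feasibleMatrices n d 0 hi, hessianMatrix A = Matrix.diagonal fun j : Fin d =>
      if (j : ℕ) = 0 then hi else if (j : ℕ) < min n (d - 1) then l else 0 := by
  set μ : ℕ → ℝ := fun j => if j = 0 then hi else if j < min n (d - 1) then l else 0 with hμ
  have hmem : ∀ j, μ j ∈ Set.Icc 0 hi := by
    intro j
    simp only [hμ]
    split_ifs
    exacts [⟨hhi.le, le_rfl⟩, hl, ⟨le_rfl, hhi.le⟩]
  have hH : hessianMatrix (rectDiagonal n d μ) = Matrix.diagonal fun j : Fin d => μ j := by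
    refine hessianMatrix_rectDiagonal (by omega) (fun j => (hmem j).1) fun j hj => ?_
    simp only [hμ]
    rw [if_neg (by omega), if_neg (by omega)]
  refine ⟨rectDiagonal n d μ, ?_, hH⟩
  change convexHull ℝ (spectrum ℝ (hessianMatrix (rectDiagonal n d μ))) = _
  rw [hH, spectrum_diagonal]
  apply Set.Subset.antisymm
  · refine convexHull_min ?_ (convex_Icc 0 hi)
    rintro _ ⟨j, rfl⟩
    exact hmem j
  · rw [← segment_eq_Icc hhi.le, ← convexHull_pair]
    refine convexHull_mono ?_
    rintro x (rfl | rfl)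
    · refine ⟨⟨d - 1, by omega⟩, ?_⟩
      simp only [hμ]
      rw [if_neg (by omega), if_neg (by omega)]
    · exact ⟨⟨0, by omega⟩, by simp [hμ]⟩

/-! ### The largest spectral loss and its behaviour in `k` -/

/-- The largest value of the spectral loss on `[0, hi]`, for the step size `1 / hi`. -/
noncomputable def lossSup (hi : ℝ) (k : ℕ) (a b : ℝ) : ℝ :=
  sSup (spectralLoss (1 / hi) k a b '' Set.Icc 0 hi)

theorem continuous_spectralLoss (α : ℝ) (k : ℕ) (a b : ℝ) :
    Continuous (spectralLoss α k a b) := by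
  have := continuous_residual k
  unfold spectralLoss
  fun_prop

theorem le_lossSup {hi : ℝ} (k : ℕ) (a b : ℝ) {l : ℝ} (hl : l ∈ Set.Icc 0 hi) :
    spectralLoss (1 / hi) k a b l ≤ lossSup hi k a b :=
  le_csSup (isCompact_Icc.bddAbove_image (continuous_spectralLoss _ k a b).continuousOn)
    ⟨l, hl, rfl⟩

/-- Continuity in the weights is what lets the limit `d → ∞` pass through the supremum. -/
theorem continuous_lossSup (hi : ℝ) (k : ℕ) :
    Continuous fun p : ℝ × ℝ => lossSup hi k p.1 p.2 := by
  refine isCompact_Icc.continuous_sSup (f := fun p : ℝ × ℝ => spectralLoss (1 / hi) k p.1 p.2) ?_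
  have := continuous_residual k
  change Continuous fun q : (ℝ × ℝ) × ℝ =>
    (q.1.1 * q.2 ^ 2 + q.1.2 * q.2) * residual k (1 / hi * q.2) ^ 2
  fun_prop

theorem isGreatest_adversarialValues {Ω : Type*} [MeasurableSpace Ω] {P : Measure Ω}
    [IsProbabilityMeasure P] {x₀ xs : Ω → EuclideanSpace ℝ (Fin d)}
    {η : Ω → EuclideanSpace ℝ (Fin n)} {R Rt C Ct : ℝ}
    (h : VectorAssumption P x₀ xs η R Rt C Ct) (hn : 1 ≤ n) (hd : 2 ≤ d) {hi : ℝ} (hhi : 0 < hi)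
    (k : ℕ) :
    IsGreatest (adversarialValues P x₀ xs η 0 hi k)
      (spectralLoss (1 / hi) k (R ^ 2 / d) (Rt ^ 2 / n) hi +
        lossSup hi k (((min n (d - 1) : ℕ) - 1 : ℝ) * (R ^ 2 / d))
          (((min n (d - 1) : ℕ) - 1 : ℝ) * (Rt ^ 2 / n))) := by
  set a := R ^ 2 / (d : ℝ) with ha
  set b := Rt ^ 2 / (n : ℝ) with hb
  set K := min n (d - 1) with hK
  set φ := spectralLoss (1 / hi) k a b with hφ
  have hK1 : 1 ≤ K := by omega
  have hK0 : (0 : ℝ) ≤ (K : ℝ) - 1 := by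
    have : (1 : ℝ) ≤ K := by exact_mod_cast hK1
    linarith
  have hφ0 : φ 0 = 0 := by simp [hφ, spectralLoss]
  obtain ⟨l, hl, hmax⟩ := isCompact_Icc.exists_isMaxOn (Set.nonempty_Icc.2 hhi.le)
    (continuous_spectralLoss (1 / hi) k a b).continuousOn
  -- The loss is linear in its weights, so the multiplicity `K - 1` moves inside the supremum, where
  -- the products `(K - 1) a` and `(K - 1) b` have limits.
  have hscale : ∀ x, spectralLoss (1 / hi) k ((K - 1 : ℝ) * a) ((K - 1 : ℝ) * b) x =
      (K - 1 : ℝ) * φ x := fun x => by simp only [hφ, spectralLoss]; ring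
  have hsup : lossSup hi k ((K - 1 : ℝ) * a) ((K - 1 : ℝ) * b) = (K - 1 : ℝ) * φ l := by
    apply le_antisymm
    · refine csSup_le (Set.Nonempty.image _ ⟨l, hl⟩) ?_
      rintro _ ⟨x, hx, rfl⟩
      rw [hscale]
      exact mul_le_mul_of_nonneg_left (hmax hx) hK0
    · rw [← hscale]
      exact le_lossSup k _ _ hl
  rw [hsup]
  constructor
  · obtain ⟨A, hA, hHA⟩ := exists_feasible_diagonal hn hd hhi hl
    refine ⟨A, hA, ?_⟩
    have hval := (h.nesterovGradSq_moment A k).2 _ fun p => by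
      rw [hHA, aeval_diagonal, Matrix.trace_diagonal]
    simp only
    rw [hval, topEigenvalue_of_feasible hhi.le hA]
    exact sum_extremal φ hφ0 hK1 (by omega) hi l
  · rintro _ ⟨A, hA, rfl⟩
    simp only
    rw [(h.nesterovGradSq_moment A k).2 _
      (trace_aeval_eigenvalues (isHermitian_hessianMatrix A)), topEigenvalue_of_feasible hhi.le hA]
    refine sum_eigenvalues_le hhi hA hφ0 ?_ fun x hx => hmax hx
    have h0 : φ 0 ≤ φ l := hmax ⟨le_rfl, hhi.le⟩
    rwa [hφ0] at h0

theorem spectralLoss_scaled {hi : ℝ} (hhi : 0 < hi) (k : ℕ) (a b u : ℝ) :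
    spectralLoss (1 / hi) k a b (hi * u) =
      a * hi ^ 2 * (u ^ 2 * residual k u ^ 2) + b * hi * (u * residual k u ^ 2) := by
  rw [spectralLoss, show 1 / hi * (hi * u) = u by field_simp]
  ring

theorem lossSup_le {hi a b : ℝ} (hhi : 0 < hi) (ha : 0 ≤ a) (hb : 0 ≤ b) (k : ℕ) :
    lossSup hi k a b ≤ a * hi ^ 2 * signalSup k + b * hi * noiseSup k := by
  refine csSup_le (Set.Nonempty.image _ ⟨0, le_rfl, hhi.le⟩) ?_
  rintro _ ⟨l, hl, rfl⟩
  have hu : l / hi ∈ Set.Icc (0 : ℝ) 1 := ⟨div_nonneg hl.1 hhi.le, (div_le_one hhi).2 hl.2⟩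
  rw [show l = hi * (l / hi) by field_simp, spectralLoss_scaled hhi]
  have h1 := le_signalSup k hu
  have h2 := le_noiseSup k hu
  gcongr

theorem scaled_mem {hi u : ℝ} (hhi : 0 < hi) (hu : u ∈ Set.Icc (0 : ℝ) 1) :
    hi * u ∈ Set.Icc 0 hi := ⟨mul_nonneg hhi.le hu.1, mul_le_of_le_one_right hhi.le hu.2⟩

theorem signalSup_le_lossSup {hi a b : ℝ} (hhi : 0 < hi) (hb : 0 ≤ b) (k : ℕ) :
    a * hi ^ 2 * signalSup k ≤ lossSup hi k a b := by
  obtain ⟨u, hu, heq⟩ := isCompact_Icc.exists_sSup_image_eq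
    (Set.nonempty_Icc.2 (zero_le_one (α := ℝ)))
    (f := fun u => u ^ 2 * residual k u ^ 2)
    (by have := continuous_residual k; fun_prop)
  rw [signalSup, heq]
  refine le_trans ?_ (le_lossSup k a b (scaled_mem hhi hu))
  rw [spectralLoss_scaled hhi]
  have := hu.1
  exact le_add_of_nonneg_right (by positivity)

theorem noiseSup_le_lossSup {hi a b : ℝ} (hhi : 0 < hi) (ha : 0 ≤ a) (k : ℕ) :
    b * hi * noiseSup k ≤ lossSup hi k a b := by
  obtain ⟨u, hu, heq⟩ := isCompact_Icc.exists_sSup_image_eq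
    (Set.nonempty_Icc.2 (zero_le_one (α := ℝ)))
    (f := fun u => u * residual k u ^ 2)
    (by have := continuous_residual k; fun_prop)
  rw [noiseSup, heq]
  refine le_trans ?_ (le_lossSup k a b (scaled_mem hhi hu))
  rw [spectralLoss_scaled hhi]
  exact le_add_of_nonneg_left (by positivity)

/-- Without the noise weight the upper and lower bounds by `signalSup` coincide. -/
theorem lossSup_isEquivalent_of_noiseless {hi R : ℝ} (hhi : 0 < hi) (hR : 0 < R) :
    (fun k => lossSup hi k (R ^ 2) 0) ~[atTop] fun k : ℕ =>
      8 * Real.exp (-(1 / 2)) / (Real.sqrt 2 * Real.pi) * hi ^ 2 * R ^ 2 *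
        (1 / (k : ℝ) ^ (7 / 2 : ℝ)) := by
  have heq : ∀ k, lossSup hi k (R ^ 2) 0 = R ^ 2 * hi ^ 2 * signalSup k := fun k =>
    le_antisymm (by simpa using lossSup_le hhi (sq_nonneg R) le_rfl k)
      (signalSup_le_lossSup hhi le_rfl k)
  apply isEquivalent_of_tendsto_one
  set c := 8 * Real.exp (-(1 / 2)) / (Real.sqrt 2 * Real.pi) with hc
  have hc0 : 0 < c := by positivity
  have h := tendsto_signalSup.div_const c
  rw [← hc, div_self hc0.ne'] at h
  refine h.congr' ?_
  filter_upwards [eventually_ge_atTop 1] with k hk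
  have hk0 : (0 : ℝ) < (k : ℝ) ^ (7 / 2 : ℝ) := by positivity
  simp only [Pi.div_apply, heq]
  field_simp

/-- The supremum lies between its noise part and the sum of both parts, and the signal part, of
order `k^{-7/2}`, disappears after multiplication by `k²`. -/
theorem lossSup_isEquivalent_of_noise {hi R Rt : ℝ} (hhi : 0 < hi) (hRt : 0 < Rt) :
    (fun k => lossSup hi k (R ^ 2) (Rt ^ 2)) ~[atTop] fun k : ℕ =>
      4 * besselJ1SqSup * hi * Rt ^ 2 * (1 / (k : ℝ) ^ 2) := by
  have hJ := besselJ1SqSup_pos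
  have hsig : Tendsto (fun k : ℕ => (k : ℝ) ^ 2 * signalSup k) atTop (𝓝 0) := by
    have h1 : Tendsto (fun k : ℕ => (k : ℝ) ^ (3 / 2 : ℝ)) atTop atTop :=
      (tendsto_rpow_atTop (by norm_num)).comp tendsto_natCast_atTop_atTop
    refine (tendsto_signalSup.div_atTop h1).congr' ?_
    filter_upwards [eventually_ge_atTop 1] with k hk
    have hk0 : (0 : ℝ) < k := by exact_mod_cast hk
    have h2 : (k : ℝ) ^ (7 / 2 : ℝ) = (k : ℝ) ^ 2 * (k : ℝ) ^ (3 / 2 : ℝ) := by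
      rw [← Real.rpow_natCast, ← Real.rpow_add hk0]; norm_num
    rw [h2]
    field_simp
  have hlow := tendsto_noiseSup.const_mul (Rt ^ 2 * hi)
  have hup := (hsig.const_mul (R ^ 2 * hi ^ 2)).add hlow
  rw [mul_zero, zero_add] at hup
  have hlim : Tendsto (fun k : ℕ => (k : ℝ) ^ 2 * lossSup hi k (R ^ 2) (Rt ^ 2)) atTop
      (𝓝 (Rt ^ 2 * hi * (4 * besselJ1SqSup))) := by
    refine tendsto_of_tendsto_of_tendsto_of_le_of_le hlow hup (fun k => ?_) fun k => ?_
    · have := mul_le_mul_of_nonneg_left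
        (noiseSup_le_lossSup (b := Rt ^ 2) hhi (sq_nonneg R) k) (sq_nonneg (k : ℝ))
      simp only
      linarith
    · have := mul_le_mul_of_nonneg_left
        (lossSup_le hhi (sq_nonneg R) (sq_nonneg Rt) k) (sq_nonneg (k : ℝ))
      simp only
      linarith
  apply isEquivalent_of_tendsto_one
  have h := hlim.div_const (Rt ^ 2 * hi * (4 * besselJ1SqSup))
  rw [div_self (by positivity)] at h
  refine h.congr' ?_
  filter_upwards [eventually_ge_atTop 1] with k hk
  have hk0 : (0 : ℝ) < k := by exact_mod_cast hk
  simp only [Pi.div_apply]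
  field_simp

/-! ### The limit of large dimension -/

theorem tendsto_sub_one_div {n d : ℕ → ℕ} (hd : Tendsto d atTop atTop)
    (hdn : Tendsto (fun m => (d m : ℝ) / (n m : ℝ)) atTop (𝓝 1)) :
    Tendsto (fun m => ((min (n m) (d m - 1) : ℕ) - 1 : ℝ) / d m) atTop (𝓝 1) := by
  have hinv : Tendsto (fun m => 1 / (d m : ℝ)) atTop (𝓝 0) :=
    (tendsto_one_div_atTop_nhds_zero_nat (𝕜 := ℝ)).comp hd
  have hnd : Tendsto (fun m => (n m : ℝ) / d m) atTop (𝓝 1) := by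
    have h := hdn.inv₀ one_ne_zero
    rw [inv_one] at h
    exact h.congr fun m => inv_div _ _
  have hone : Tendsto (fun m => 1 - 1 / (d m : ℝ)) atTop (𝓝 1) := by
    simpa using hinv.const_sub 1
  have h := (hnd.min hone).sub hinv
  rw [min_self, sub_zero] at h
  refine h.congr' ?_
  filter_upwards [hd.eventually_ge_atTop 1] with m hm
  have hd0 : (0 : ℝ) < d m := by exact_mod_cast hm
  have h1 : 1 - 1 / (d m : ℝ) = ((d m - 1 : ℕ) : ℝ) / d m := by
    rw [Nat.cast_sub hm]; field_simp; simp
  rw [h1, min_div_div_right hd0.le, ← sub_div, Nat.cast_min]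

end AdversarialNesterov

open AdversarialNesterov
theorem mainTheorem12
    (σ R Rt C Ct : ℝ) (hσ : 0 < σ) (hR : 0 < R) (hRt : 0 ≤ Rt)
    (n d : ℕ → ℕ) (hd : Tendsto d atTop atTop)
    (r : ℝ) (hdn : Tendsto (fun m => (d m : ℝ) / (n m : ℝ)) atTop (𝓝 r)) (hr : r = 1)
    {Ω : ℕ → Type*} [∀ m, MeasurableSpace (Ω m)]
    (P : ∀ m, Measure (Ω m)) [∀ m, IsProbabilityMeasure (P m)]
    (x₀ xs : ∀ m, Ω m → EuclideanSpace ℝ (Fin (d m)))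
    (η : ∀ m, Ω m → EuclideanSpace ℝ (Fin (n m)))
    (hvec : ∀ m, VectorAssumption (P m) (x₀ m) (xs m) (η m) R Rt C Ct) :
    (∀ m k, ∀ A ∈ feasibleMatrices (n m) (d m) (mpLowerEdge σ r) (mpUpperEdge σ r),
      Integrable (fun ω => nesterovGradSq A (x₀ m ω) (xs m ω) (η m ω) k) (P m)) ∧
    ∃ (M : ℕ → ℕ → ℝ) (L : ℕ → ℝ),
      (∀ k, ∀ᶠ m in atTop,
        IsGreatest (adversarialValues (P m) (x₀ m) (xs m) (η m)
          (mpLowerEdge σ r) (mpUpperEdge σ r) k) (M k m)) ∧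
      (∀ k, Tendsto (M k) atTop (𝓝 (L k))) ∧
      (Rt = 0 →
        L ~[atTop] fun k : ℕ =>
          8 * Real.exp (-(1 / 2)) / (Real.sqrt 2 * Real.pi) * mpUpperEdge σ r ^ 2 * R ^ 2 *
            (1 / (k : ℝ) ^ (7 / 2 : ℝ))) ∧
      (0 < Rt →
        L ~[atTop] fun k : ℕ =>
          4 * besselJ1SqSup * mpUpperEdge σ r * Rt ^ 2 * (1 / (k : ℝ) ^ 2)) := by
  subst hr
  have hlo : mpLowerEdge σ 1 = 0 := by simp [mpLowerEdge]
  have hhi : 0 < mpUpperEdge σ 1 := by unfold mpUpperEdge; positivity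
  rw [hlo]
  set hi := mpUpperEdge σ 1
  refine ⟨fun m k A _ => ((hvec m).nesterovGradSq_moment A k).1, fun k m =>
    spectralLoss (1 / hi) k (R ^ 2 / d m) (Rt ^ 2 / n m) hi +
      lossSup hi k (((min (n m) (d m - 1) : ℕ) - 1 : ℝ) * (R ^ 2 / d m))
        (((min (n m) (d m - 1) : ℕ) - 1 : ℝ) * (Rt ^ 2 / n m)),
    fun k => lossSup hi k (R ^ 2) (Rt ^ 2), fun k => ?_, fun k => ?_, fun h0 => ?_,
    fun h0 => lossSup_isEquivalent_of_noise hhi h0⟩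
  · filter_upwards [hd.eventually_ge_atTop 2, hdn.eventually_ne one_ne_zero] with m h1 h2
    -- If `n m = 0`, the quotient `d m / n m` would be `0` by convention, which the limit `1` rules
    -- out eventually.
    have hn : 1 ≤ n m := by
      rw [Nat.one_le_iff_ne_zero]
      intro h0
      simp [h0] at h2
    exact isGreatest_adversarialValues (hvec m) hn h1 hhi k
  · have hK := tendsto_sub_one_div hd hdn
    have hinv : Tendsto (fun m => 1 / (d m : ℝ)) atTop (𝓝 0) :=
      (tendsto_one_div_atTop_nhds_zero_nat (𝕜 := ℝ)).comp hd
    have hdne : ∀ᶠ m in atTop, (d m : ℝ) ≠ 0 := by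
      filter_upwards [hd.eventually_ge_atTop 1] with m hm
      exact_mod_cast (by omega : d m ≠ 0)
    have ha : Tendsto (fun m => R ^ 2 / (d m : ℝ)) atTop (𝓝 0) := by
      simpa [div_eq_mul_inv] using hinv.const_mul (R ^ 2)
    have hb : Tendsto (fun m => Rt ^ 2 / (n m : ℝ)) atTop (𝓝 0) := by
      have h := (hinv.mul hdn).const_mul (Rt ^ 2)
      rw [zero_mul, mul_zero] at h
      refine h.congr' ?_
      filter_upwards [hdne] with m hm
      field_simp
    have hKa : Tendsto (fun m => ((min (n m) (d m - 1) : ℕ) - 1 : ℝ) * (R ^ 2 / d m)) atTop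
        (𝓝 (R ^ 2)) := by
      have h := hK.mul_const (R ^ 2)
      rw [one_mul] at h
      exact h.congr fun m => by ring
    have hKb : Tendsto (fun m => ((min (n m) (d m - 1) : ℕ) - 1 : ℝ) * (Rt ^ 2 / n m)) atTop
        (𝓝 (Rt ^ 2)) := by
      have h := (hK.mul hdn).mul_const (Rt ^ 2)
      rw [one_mul, one_mul] at h
      refine h.congr' ?_
      filter_upwards [hdne] with m hm
      field_simp
    -- The forced eigenvalue at the upper edge occurs once, with weights `R²/d` and `R̃²/n`, so its
    -- contribution tends to `0`.
    have hedge := ((ha.mul_const (hi ^ 2)).add (hb.mul_const hi)).mul_const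
      (residual k (1 / hi * hi) ^ 2)
    have hsup := ((continuous_lossSup hi k).tendsto (R ^ 2, Rt ^ 2)).comp (hKa.prodMk_nhds hKb)
    have h := hedge.add hsup
    rw [zero_mul, zero_mul, zero_add, zero_mul, zero_add] at h
    exact h
  · subst h0
    have h := lossSup_isEquivalent_of_noiseless hhi hR
    simpa using h
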